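/- Consider a Markov decision process with finite state space $\mathscr S$ and finite action space $\mathscr A$, transition probabilities $p(s'\mid s,a)$, rewards $r(s,a,s')\in[-r_{\max},r_{\max}]$ with $r_{\max}>0$, discount factor $\gamma\in(0,1)$, a fixed initial state, and an absorbing terminal state $0\in\mathscr S$. For an episode $(S_t,A_t)_{t\ge 0}$, let $T=\min\{t: S_t=0\}$ be its length and $\sum_{t=0}^{T-1}\gamma^t r(S_t,A_t,S_{t+1})$ its cumulative reward. Let $\{\pi_\theta:\theta\in\mathbb R^d\}$ be stochastic policies and $b$ a behavior policy, and let $R^\theta$ (resp. $R^b$) be the cumulative reward of an episode generated by $\pi_\theta$ (resp. $b$). Put $M_r=r_{\max}/(1-\gamma)$. Let $g:[0,1]\to[0,1]$ be continuous and non-decreasing with $g(0)=0$, $g(1)=1$, twice differentiable on $(0,1)$ with $|g'|\le M_{g'}$ and $|g''|\le M_{g''}$ there; at $0$ and $1$, $g'$ denotes the one-sided derivative. With $F_{R^\theta}$ the distribution function of $R^\theta$, let $$\rho_g(\theta)=\int_{-M_r}^0\big(g(1-F_{R^\theta}(x))-1\big)\,dx+\int_0^{M_r}g(1-F_{R^\theta}(x))\,dx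 .$$ Assume: * the policies are proper: there is $n\ge 1$ such that $\max_{s}\mathbb P(S_n\ne 0\mid S_0=s,\pi_\theta)<1$ for all $\theta$, and there is $n\ge1$ such that $\max_s\mathbb P(S_n\neq 0\mid S_0=s,b)<1$; * $\pi_\theta(a|s)>0$ for all $\theta,s,a$, and $b(a|s)=0$ implies $\pi_\theta(a|s)=0$; * for all $s,a$ the map $\theta\mapsto\log\pi_\theta(a|s)$ is twice differentiable with $\|\nabla\log\pi_\theta(a|s)\|\le M_d$ and $\|\nabla^2\log\pi_\theta(a|s)\|\le M_h$ (operator norm) for all $\theta$; * under $b$, $T\le M_e$ almost surely, and for every $\theta$ the importance sampling ratio $\psi^\theta=\prod_{t=0}^{T-1}\frac{\pi_\theta(A_t|S_t)}{b(A_t|S_t)}$ satisfies $\psi^\theta\le M_s$ almost surely. Given $m$ episodes of $b$ with lengths $T^i$, cumulative rewards $R^b_i$ and ratios $\psi^\theta_i$, let $$H^m_{R^\theta}(x)=\min\Big\{\tfrac1m\sum_{i=1}^m\mathbf 1\{R^b_i\le x\}\psi^\theta_i,\,1\Big\},\qquad \widehat\nabla H^m_{R^\theta}(x)=\tfrac1m\sum_{i=1}^m\mathbf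 1\{R^b_i\le x\}\,\psi_i^\theta\sum_{t=0}^{T^i-1}\nabla\log\pi_\theta(A^i_t|S^i_t),$$ $$\widehat\nabla^H\rho_g(\theta)=-\int_{-M_r}^{M_r}g'\big(1-H^m_{R^\theta}(x)\big)\,\widehat\nabla H^m_{R^\theta}(x)\,dx .$$ Let $N\ge1$, $\alpha=1/\sqrt N$ and $m=\lceil\sqrt N\rceil$ (so $m=\sqrt N$ when $N$ is a perfect square). Starting from a fixed $\theta_0\in\mathbb R^d$, let $\theta_{k+1}=\theta_k+\alpha\widehat\nabla^H\rho_g(\theta_k)$ for $0\le k<N$, where each step uses a fresh batch of $m$ episodes of $b$ and all $Nm$ episodes are independent, and let $R$ be uniformly distributed on $\{1,\dots,N\}$ and independent of the episodes. Then $\rho_g$ is differentiable and bounded above, $\|\nabla\rho_g(\theta_R)\|^2$ is integrable, and, with $\rho_g^*=\sup_{\theta}\rho_g(\theta)$ and $$L_{\rho'}=2M_rM_e\big(M_hM_{g'}+M_eM_d^2(M_{g'}+M_{g''})\big),$$ $$\mathbb E\big[\|\nabla\rho_g(\theta_R)\|^2\big]\le\frac{2(\rho_g^*-\rho_g(\theta_0))}{\sqrt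 N}+\frac{4M_r^2M_s^2M_e^2M_d^2\big(M_{g'}^2L_{\rho'}+8(e^2M_{g'}^2+M_{g''}^2M_s^2)\big)}{\sqrt N}.$$ -/

import Mathlib

open MeasureTheory ProbabilityTheory

noncomputable section

/-- A finite episodic Markov decision process with discounted, bounded rewards. -/
structure EpisodicMDP (S A : Type*) where
  /-- `p s a` is the distribution of the next state after taking action `a` in state `s`. -/
  p : S → A → PMF S
  /-- `r s a s'` is the reward of the transition from `s` to `s'` under action `a`. -/
  r : S → A → S → ℝ
  /-- the fixed initial state -/
  start : S
  /-- the terminal state -/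
  terminal : S
  /-- the discount factor -/
  γ : ℝ
  /-- the bound on the one-step rewards -/
  rmax : ℝ
  absorbing : ∀ a, p terminal a = PMF.pure terminal
  γ_pos : 0 < γ
  γ_lt_one : γ < 1
  rmax_pos : 0 < rmax
  abs_r_le : ∀ s a s', |r s a s'| ≤ rmax

namespace EpisodicMDP

variable {S A : Type*} (M : EpisodicMDP S A)

/-! ### Trajectories: `ω t = (S_t, A_t)` -/

/-- The length `T` of an episode, i.e. the first time at which the terminal state is visited
(meaningful only for trajectories which visit it, see `Terminates`). -/
def length (ω : ℕ → S × A) : ℕ := sInf {t | (ω t).1 = M.terminal}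

/-- The trajectory visits the terminal state, i.e. `T < ∞`. -/
def Terminates (ω : ℕ → S × A) : Prop := ∃ t, (ω t).1 = M.terminal

/-- The cumulative discounted reward `∑_{t < T} γ^t r(S_t, A_t, S_{t+1})`. -/
def cumReward (ω : ℕ → S × A) : ℝ :=
  ∑ t ∈ Finset.range (M.length ω), M.γ ^ t * M.r (ω t).1 (ω t).2 (ω (t + 1)).1

/-- The importance sampling ratio `∏_{t < T} π(A_t | S_t) / b(A_t | S_t)`. -/
def isRatio (π b : S → PMF A) (ω : ℕ → S × A) : ℝ :=
  ∏ t ∈ Finset.range (M.length ω),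
    (π (ω t).1 (ω t).2).toReal / (b (ω t).1 (ω t).2).toReal

/-- The constant `M_r = r_max / (1 - γ)`. -/
def rewardBound : ℝ := M.rmax / (1 - M.γ)

section Law

variable [Fintype S] [Fintype A] [MeasurableSpace S] [DiscreteMeasurableSpace S]
  [MeasurableSpace A] [DiscreteMeasurableSpace A]

/-- The conditional law of `(S_{t+1}, A_{t+1})` given the history up to time `t` when the policy
`π` is followed: `S_{t+1} ∼ p(· | S_t, A_t)` and then `A_{t+1} ∼ π(· | S_{t+1})`. -/
def stepKernel (π : S → PMF A) (t : ℕ) :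
    Kernel ((_ : Finset.Iic t) → S × A) (S × A) :=
  Kernel.ofFunOfCountable fun h =>
    ((M.p (h ⟨t, Finset.mem_Iic.2 le_rfl⟩).1 (h ⟨t, Finset.mem_Iic.2 le_rfl⟩).2).bind
      fun s' => (π s').map (Prod.mk s')).toMeasure

instance (π : S → PMF A) (t : ℕ) : IsMarkovKernel (M.stepKernel π t) :=
  ⟨fun _ => by
    simp only [stepKernel, Kernel.ofFunOfCountable, Kernel.coe_mk]
    infer_instance⟩

/-- The law of the trajectory `(S_t, A_t)_{t ≥ 0}` generated by the policy `π` from `S_0 = s`. -/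
def law (π : S → PMF A) (s : S) : Measure (ℕ → S × A) :=
  Kernel.trajMeasure (X := fun _ => S × A) ((π s).map (Prod.mk s)).toMeasure (M.stepKernel π)

/-- The cumulative distribution function of the cumulative reward of the policy `π`. -/
def rewardCDF (π : S → PMF A) (x : ℝ) : ℝ :=
  (M.law π M.start).real {ω | M.cumReward ω ≤ x}

/-- The distortion risk measure of the cumulative reward of the policy `π`, for the distortion
function `g`. -/
def drm (g : ℝ → ℝ) (π : S → PMF A) : ℝ :=
  (∫ x in (-M.rewardBound)..0, (g (1 - M.rewardCDF π x) - 1)) +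
    ∫ x in (0 : ℝ)..M.rewardBound, g (1 - M.rewardCDF π x)

end Law

/-! ### The off-policy likelihood ratio algorithm -/

section Algorithm

variable {d m : ℕ} (π : EuclideanSpace ℝ (Fin d) → S → PMF A) (b : S → PMF A)

/-- `θ ↦ log π_θ(a | s)` -/
def logPolicy (s : S) (a : A) (θ : EuclideanSpace ℝ (Fin d)) : ℝ :=
  Real.log (π θ s a).toReal

/-- The score `∑_{t < T} ∇ log π_θ(A_t | S_t)` of an episode. -/
def score (θ : EuclideanSpace ℝ (Fin d)) (ω : ℕ → S × A) : EuclideanSpace ℝ (Fin d) :=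
  ∑ t ∈ Finset.range (M.length ω), gradient (logPolicy π (ω t).1 (ω t).2) θ

/-- The importance sampling estimate `H^m(x)`, capped at `1`, of the distribution function of the
cumulative reward of `π_θ` from a batch `ω` of `m` episodes of the behavior policy `b`. -/
def cdfEstimate (θ : EuclideanSpace ℝ (Fin d)) (ω : Fin m → ℕ → S × A) (x : ℝ) : ℝ :=
  min ((1 / (m : ℝ)) * ∑ i, Set.indicator {ω' | M.cumReward ω' ≤ x}
    (fun ω' => M.isRatio (π θ) b ω') (ω i)) 1

/-- The estimate of the gradient in `θ` of the distribution function of the cumulative reward. -/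
def cdfGradEstimate (θ : EuclideanSpace ℝ (Fin d)) (ω : Fin m → ℕ → S × A) (x : ℝ) :
    EuclideanSpace ℝ (Fin d) :=
  (1 / (m : ℝ)) • ∑ i, Set.indicator {ω' | M.cumReward ω' ≤ x}
    (fun ω' => M.isRatio (π θ) b ω' • M.score π θ ω') (ω i)

/-- The estimate `-∫_{-M_r}^{M_r} g'(1 - H^m(x)) ∇̂H^m(x) dx` of the gradient of the distortion risk
measure. The derivative of `g` is taken within `[0, 1]`, so it is one-sided at the end points. -/
def drmGradEstimate (g : ℝ → ℝ) (θ : EuclideanSpace ℝ (Fin d)) (ω : Fin m → ℕ → S × A) :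
    EuclideanSpace ℝ (Fin d) :=
  -∫ x in (-M.rewardBound)..M.rewardBound,
    derivWithin g (Set.Icc 0 1) (1 - M.cdfEstimate π b θ ω x) • M.cdfGradEstimate π b θ ω x

/-- The iterates `θ_{k+1} = θ_k + α ∇̂ρ_g(θ_k)`, where the `k`-th update uses the batch `ξ k` of `m`
episodes. -/
def iterate (g : ℝ → ℝ) (α : ℝ) (θ₀ : EuclideanSpace ℝ (Fin d))
    (ξ : ℕ → Fin m → ℕ → S × A) : ℕ → EuclideanSpace ℝ (Fin d)
  | 0 => θ₀
  | k + 1 => iterate g α θ₀ ξ k + α • M.drmGradEstimate π b g (iterate g α θ₀ ξ k) (ξ k)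

end Algorithm

end EpisodicMDP

end

/-! The episode length is bounded by `Me` almost surely under `b`, so an episode is determined, up
to the irrelevant actions taken after termination, by a path of length `⌊Me⌋₊ + 1` in a finite set.
The theorem thus becomes a statement about a finite weighted set of paths (`ImportanceModel`):
measurability and integrability over episodes become automatic, and expectations become finite sums.

The change of measure is exact on this set: the weight of a path under `π θ` is its weight under `b`
times the importance ratio (`pathWeight_eq_mul_isRatio`). Hence the reward distribution function is
a finite sum of terms smooth in `θ`, with logarithmic derivative given by the score. Since the
ratios have mean one, this function and its gradient have Lipschitz constants free of `Ms`. Combined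
with a Lipschitz extension of `g'` to the closed interval, this gives the gradient of the risk
measure and its Lipschitz constant `L` (`hasGradientAt_integral`, `norm_riskGrad_sub_le`).

The gradient estimate is biased, because `g'` is applied to an estimate, but its mean squared error
is `O(1/m)`: the empirical averages have variance `O(1/m)`, the integrand is Lipschitz in them, and
Cauchy-Schwarz handles the integral in `x` (`integral_norm_riskGradEst_sub_sq_le`).

Finally, the ascent inequality bounds `‖∇ρ‖²` at each iterate by the increase of `ρ`, the squared
error of the estimate and `L α` times its squared norm (`half_norm_sq_le_of_ascent`). No
unbiasedness is needed. Taking expectations and telescoping bounds the average over the indices `0,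
…, N - 1`; moving to `1, …, N` costs one extra term, absorbed by slack in the stated constant. -/

noncomputable section

namespace EpisodicMDP

variable {S A : Type*} (M : EpisodicMDP S A)

/-! ### Collapsing and truncating trajectories -/

open Classical in
/-- Replace the (irrelevant) actions taken in the terminal state by a fixed action. -/
def collapse (a₀ : A) (x : S × A) : S × A := if x.1 = M.terminal then (M.terminal, a₀) else x

lemma collapse_fst (a₀ : A) (x : S × A) : (M.collapse a₀ x).1 = x.1 := by
  unfold collapse; split_ifs with h
  · exact h.symm
  · rfl

lemma collapse_of_ne (a₀ : A) {x : S × A} (h : x.1 ≠ M.terminal) : M.collapse a₀ x = x := if_neg h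

/-- The first `K + 1` steps of a trajectory, with collapsed terminal actions. -/
def truncate (a₀ : A) (K : ℕ) (ω : ℕ → S × A) : Fin (K + 1) → S × A :=
  fun i => M.collapse a₀ (ω i)

/-- Extend a finite path to a trajectory which stays in its last position. -/
def extendPath {X : Type*} {K : ℕ} (h : Fin (K + 1) → X) : ℕ → X :=
  fun t => h ⟨min t K, by omega⟩

lemma extendPath_truncate (a₀ : A) (K : ℕ) (ω : ℕ → S × A) (t : ℕ) :
    extendPath (M.truncate a₀ K ω) t = M.collapse a₀ (ω (min t K)) := rfl

/-- The terminal state is visited not later than time `K`. -/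
def TerminatesBy (K : ℕ) (ω : ℕ → S × A) : Prop := ∃ t ≤ K, (ω t).1 = M.terminal

variable {M}

lemma TerminatesBy.terminates {K : ℕ} {ω : ℕ → S × A} (h : M.TerminatesBy K ω) :
    M.Terminates ω := let ⟨t, _, ht⟩ := h; ⟨t, ht⟩

lemma TerminatesBy.length_le {K : ℕ} {ω : ℕ → S × A} (h : M.TerminatesBy K ω) :
    M.length ω ≤ K := let ⟨_, htK, ht⟩ := h; (Nat.sInf_le ht).trans htK

lemma Terminates.fst_length {ω : ℕ → S × A} (h : M.Terminates ω) :
    (ω (M.length ω)).1 = M.terminal := Nat.sInf_mem h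

lemma fst_ne_terminal_of_lt_length {ω : ℕ → S × A} {t : ℕ} (h : t < M.length ω) :
    (ω t).1 ≠ M.terminal := fun ht => (Nat.notMem_of_lt_sInf h) ht

variable (M)

lemma terminatesBy_floor {ω : ℕ → S × A} {c : ℝ} (h : M.Terminates ω) (hc : (M.length ω : ℝ) ≤ c) :
    M.TerminatesBy ⌊c⌋₊ ω := ⟨M.length ω, Nat.le_floor hc, h.fst_length⟩

/-- The length is a first hitting time, so it is decided by the states up to any time by which the
terminal state has been hit. -/
lemma length_eq_of {ω ω' : ℕ → S × A} {K : ℕ} (h : M.TerminatesBy K ω)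
    (hω : ∀ t ≤ K, (ω' t).1 = (ω t).1) : M.length ω' = M.length ω := by
  have hl := h.length_le
  apply le_antisymm
  · apply Nat.sInf_le
    change _ = _
    rw [hω _ hl, h.terminates.fst_length]
  · have h' : M.TerminatesBy K ω' := by
      obtain ⟨t, ht, h⟩ := h
      exact ⟨t, ht, (hω t ht).trans h⟩
    apply Nat.sInf_le
    change _ = _
    rw [← hω _ h'.length_le, h'.terminates.fst_length]

section Truncate

variable (a₀ : A) {K : ℕ} {ω : ℕ → S × A}

lemma fst_extendPath_truncate {t : ℕ} (ht : t ≤ K) :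
    (extendPath (M.truncate a₀ K ω) t).1 = (ω t).1 := by
  rw [extendPath_truncate, collapse_fst, min_eq_left ht]

lemma terminatesBy_extendPath_truncate :
    M.TerminatesBy K (extendPath (M.truncate a₀ K ω)) ↔ M.TerminatesBy K ω := by
  constructor <;> rintro ⟨t, ht, h⟩ <;> refine ⟨t, ht, ?_⟩
  · rwa [M.fst_extendPath_truncate a₀ ht] at h
  · rwa [M.fst_extendPath_truncate a₀ ht]

variable (h : M.TerminatesBy K ω)
include h

lemma length_extendPath_truncate : M.length (extendPath (M.truncate a₀ K ω)) = M.length ω :=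
  M.length_eq_of h fun _ ht => M.fst_extendPath_truncate a₀ ht

lemma extendPath_truncate_of_lt_length {t : ℕ} (ht : t < M.length ω) :
    extendPath (M.truncate a₀ K ω) t = ω t := by
  rw [extendPath_truncate, min_eq_left (ht.le.trans h.length_le),
    M.collapse_of_ne a₀ (fst_ne_terminal_of_lt_length ht)]

lemma cumReward_extendPath_truncate :
    M.cumReward (extendPath (M.truncate a₀ K ω)) = M.cumReward ω := by
  unfold cumReward
  rw [M.length_extendPath_truncate a₀ h]
  refine Finset.sum_congr rfl fun t ht => ?_
  rw [Finset.mem_range] at ht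
  rw [M.extendPath_truncate_of_lt_length a₀ h ht,
    M.fst_extendPath_truncate a₀ (Nat.succ_le_of_lt (ht.trans_le h.length_le))]

lemma isRatio_extendPath_truncate (π b : S → PMF A) :
    M.isRatio π b (extendPath (M.truncate a₀ K ω)) = M.isRatio π b ω := by
  unfold isRatio
  rw [M.length_extendPath_truncate a₀ h]
  refine Finset.prod_congr rfl fun t ht => ?_
  rw [M.extendPath_truncate_of_lt_length a₀ h (Finset.mem_range.1 ht)]

lemma score_extendPath_truncate {d : ℕ} (π : EuclideanSpace ℝ (Fin d) → S → PMF A)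
    (θ : EuclideanSpace ℝ (Fin d)) :
    M.score π θ (extendPath (M.truncate a₀ K ω)) = M.score π θ ω := by
  unfold score
  rw [M.length_extendPath_truncate a₀ h]
  refine Finset.sum_congr rfl fun t ht => ?_
  rw [M.extendPath_truncate_of_lt_length a₀ h (Finset.mem_range.1 ht)]

end Truncate

/-! ### Path probabilities -/

/-- The distribution of the next state-action pair. -/
def stepPMF (π : S → PMF A) (x : S × A) : PMF (S × A) :=
  (M.p x.1 x.2).bind fun s' => (π s').map (Prod.mk s')

/-- The terminal state is absorbing under every action, so forgetting terminal actions does not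
affect the dynamics. This is what keeps the collapsed process Markov. -/
lemma stepPMF_collapse (π : S → PMF A) (a₀ : A) (x : S × A) :
    M.stepPMF π (M.collapse a₀ x) = M.stepPMF π x := by
  by_cases h : x.1 = M.terminal
  · unfold stepPMF collapse
    rw [if_pos h, h, M.absorbing, M.absorbing]
  · rw [M.collapse_of_ne a₀ h]

section Law

variable [Fintype S] [Fintype A] [MeasurableSpace S] [DiscreteMeasurableSpace S]
  [MeasurableSpace A] [DiscreteMeasurableSpace A]

instance (π : S → PMF A) (s : S) : IsProbabilityMeasure (M.law π s) := by
  unfold law; infer_instance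

lemma measurable_truncate (a₀ : A) (K : ℕ) : Measurable (M.truncate a₀ K) := by
  refine measurable_pi_lambda _ fun i => ?_
  exact (Measurable.of_discrete (f := M.collapse a₀)).comp (measurable_pi_apply _)

/-- The probability that the first `n + 1` collapsed steps of a trajectory agree with `h`. -/
def pathProb (π : S → PMF A) (s : S) (a₀ : A) (n : ℕ) (h : ℕ → S × A) : ENNReal :=
  M.law π s {ω | ∀ t ≤ n, M.collapse a₀ (ω t) = h t}

lemma pathProb_zero (π : S → PMF A) (s : S) (a₀ : A) (h : ℕ → S × A) :
    M.pathProb π s a₀ 0 h = (π s).toMeasure {a | M.collapse a₀ (s, a) = h 0} := by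
  have hmap : (M.law π s).map (fun ω => ω 0) = ((π s).map (Prod.mk s)).toMeasure := by
    have h1 : (fun ω : ℕ → S × A => ω 0) =
        (fun u : (i : Finset.Iic 0) → S × A => u ⟨0, by simp⟩) ∘ Preorder.frestrictLe 0 := rfl
    rw [h1, ← Measure.map_map (by fun_prop) (by fun_prop), law, Kernel.trajMeasure,
      Measure.map_comp _ _ (by fun_prop), Kernel.traj_map_frestrictLe, Kernel.partialTraj_self,
      Measure.id_comp, Measure.map_map (by fun_prop) (by fun_prop)]
    convert Measure.map_id
    ext x <;> rfl
  have h2 : {ω : ℕ → S × A | ∀ t ≤ 0, M.collapse a₀ (ω t) = h t} =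
      (fun ω => ω 0) ⁻¹' {z | M.collapse a₀ z = h 0} := by
    ext ω; simp
  rw [pathProb, h2, ← Measure.map_apply (by fun_prop) (MeasurableSet.of_discrete), hmap,
    PMF.toMeasure_map_apply _ _ _ (by fun_prop) (MeasurableSet.of_discrete)]
  rfl

lemma pathProb_succ (π : S → PMF A) (s : S) (a₀ : A) (n : ℕ) (h : ℕ → S × A) :
    M.pathProb π s a₀ (n + 1) h =
      M.pathProb π s a₀ n h * (M.stepPMF π (h n)).toMeasure {z | M.collapse a₀ z = h (n + 1)} := by
  set B : Set ((_ : Finset.Iic n) → S × A) := {u | ∀ i, M.collapse a₀ (u i) = h i}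
  set C : Set (S × A) := {z | M.collapse a₀ z = h (n + 1)}
  have hB : MeasurableSet B := MeasurableSet.of_discrete
  have hC : MeasurableSet C := MeasurableSet.of_discrete
  have h1 : {ω : ℕ → S × A | ∀ t ≤ n + 1, M.collapse a₀ (ω t) = h t} =
      (fun x => (Preorder.frestrictLe n x, x (n + 1))) ⁻¹' (B ×ˢ C) := by
    ext ω
    simp only [Set.mem_ofPred_eq, Set.mem_preimage, Set.mem_prod, B, C, Subtype.forall,
      Finset.mem_Iic]
    constructor
    · exact fun H => ⟨fun t ht => H t (by omega), H _ le_rfl⟩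
    · rintro ⟨H1, H2⟩ t ht
      rcases Nat.le_succ_iff.1 ht with h | h
      · exact H1 t h
      · subst h; exact H2
  have h2 : {ω : ℕ → S × A | ∀ t ≤ n, M.collapse a₀ (ω t) = h t} =
      (Preorder.frestrictLe (π := fun _ => S × A) n) ⁻¹' B := by
    ext ω
    simp [B]
  rw [pathProb, pathProb, h1, h2, ← Measure.map_apply (by fun_prop) (hB.prod hC), law,
    ← Kernel.map_frestrictLe_trajMeasure_compProd_eq_map_trajMeasure (X := fun _ => S × A),
    Measure.compProd_apply_prod hB hC, ← Measure.map_apply (by fun_prop) hB,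
    setLIntegral_congr_fun (g := fun _ => (M.stepPMF π (h n)).toMeasure C) hB, setLIntegral_const,
    mul_comm]
  -- On `B` the last position is known only up to collapsing, which suffices because the step
  -- distribution is invariant under collapsing; so the kernel is constant on `B`.
  intro u hu
  have : M.stepPMF π (h n) = M.stepPMF π (u ⟨n, Finset.mem_Iic.2 le_rfl⟩) := by
    rw [← hu ⟨n, Finset.mem_Iic.2 le_rfl⟩, stepPMF_collapse]
  simp only [this]
  rfl

open Classical in
/-- The one-step likelihood ratio, set to `1` in the terminal state. -/
def stepRatio (π b : S → PMF A) (y : S × A) : ENNReal :=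
  if y.1 = M.terminal then 1 else π y.1 y.2 / b y.1 y.2

-- In the terminal state all actions collapse to one, so both policies give the same mass and the
-- ratio is `1`; elsewhere the event is a single action or empty.
omit [Fintype S] [Fintype A] [MeasurableSpace S] [DiscreteMeasurableSpace S] in
lemma toMeasure_collapse_eq_mul_stepRatio {π b : S → PMF A} (hb : ∀ s a, b s a ≠ 0) (a₀ : A) (s : S)
    (y : S × A) :
    (π s).toMeasure {a | M.collapse a₀ (s, a) = y} =
      (b s).toMeasure {a | M.collapse a₀ (s, a) = y} * M.stepRatio π b y := by
  by_cases hs : s = M.terminal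
  · have h1 : {a | M.collapse a₀ (s, a) = y} = {_a | (M.terminal, a₀) = y} := by
      simp [collapse, hs]
    rw [h1]
    by_cases hy : (M.terminal, a₀) = y
    · subst hy; simp [stepRatio]
    · simp [hy]
  · have h1 : {a | M.collapse a₀ (s, a) = y} = {a | (s, a) = y} := by
      ext a; rw [Set.mem_ofPred_eq, M.collapse_of_ne a₀ (x := (s, a)) hs]; rfl
    rw [h1]
    by_cases hy : s = y.1
    · have h2 : {a | (s, a) = y} = {y.2} := by
        ext a
        exact ⟨fun H => congrArg Prod.snd H, fun H => Prod.ext hy H⟩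
      rw [h2, PMF.toMeasure_apply_singleton _ _ (MeasurableSet.of_discrete),
        PMF.toMeasure_apply_singleton _ _ (MeasurableSet.of_discrete), stepRatio, if_neg (hy ▸ hs),
        hy, ENNReal.mul_div_cancel (hb _ _) (PMF.apply_ne_top _ _)]
    · have h2 : {a | (s, a) = y} = ∅ :=
        Set.eq_empty_of_forall_notMem fun a H => hy (congrArg Prod.fst H)
      simp [h2]

lemma stepPMF_toMeasure (π : S → PMF A) (x : S × A) (C : Set (S × A)) :
    (M.stepPMF π x).toMeasure C =
      ∑' s', M.p x.1 x.2 s' * (π s').toMeasure {a | (s', a) ∈ C} := by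
  rw [stepPMF, PMF.toMeasure_bind_apply _ _ _ (MeasurableSet.of_discrete)]
  refine tsum_congr fun s' => ?_
  rw [PMF.toMeasure_map_apply _ _ _ (by fun_prop) (MeasurableSet.of_discrete)]
  rfl

/-- The transition probabilities are common to both policies and cancel, so only the action ratios
survive, one for each time step. -/
lemma pathProb_eq_mul_prod_stepRatio {π b : S → PMF A} (hb : ∀ s a, b s a ≠ 0) (s : S) (a₀ : A)
    (n : ℕ) (h : ℕ → S × A) :
    M.pathProb π s a₀ n h =
      M.pathProb b s a₀ n h * ∏ t ∈ Finset.range (n + 1), M.stepRatio π b (h t) := by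
  induction n with
  | zero =>
    rw [pathProb_zero, pathProb_zero, zero_add, Finset.prod_range_one]
    exact M.toMeasure_collapse_eq_mul_stepRatio hb a₀ s _
  | succ n ih =>
    have h1 : (M.stepPMF π (h n)).toMeasure {z | M.collapse a₀ z = h (n + 1)} =
        (M.stepPMF b (h n)).toMeasure {z | M.collapse a₀ z = h (n + 1)} *
          M.stepRatio π b (h (n + 1)) := by
      rw [stepPMF_toMeasure, stepPMF_toMeasure, ← ENNReal.tsum_mul_right]
      refine tsum_congr fun s' => ?_
      rw [mul_assoc]
      congr 1
      exact M.toMeasure_collapse_eq_mul_stepRatio hb a₀ s' _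
    rw [pathProb_succ, pathProb_succ, ih, h1, Finset.prod_range_succ _ (n + 1)]
    ring

lemma terminal_of_pathProb_ne_zero {π : S → PMF A} {s : S} {a₀ : A} {n : ℕ} {h : ℕ → S × A}
    (hn : M.pathProb π s a₀ n h ≠ 0) {t : ℕ} (htn : t < n) (ht : (h t).1 = M.terminal) :
    (h (t + 1)).1 = M.terminal := by
  induction n with
  | zero => omega
  | succ n ih =>
    rw [pathProb_succ] at hn
    rcases Nat.lt_succ_iff_lt_or_eq.1 htn with h1 | rfl
    · exact ih (left_ne_zero_of_mul hn) h1
    · by_contra hne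
      apply right_ne_zero_of_mul hn
      rw [stepPMF_toMeasure, ht, M.absorbing, ENNReal.tsum_eq_zero]
      intro s'
      by_cases hs : s' = M.terminal
      · have : {a | (s', a) ∈ {z | M.collapse a₀ z = h (t + 1)}} = ∅ := by
          ext a
          simp only [Set.mem_ofPred_eq, Set.mem_empty_iff_false, iff_false]
          intro H
          rw [← H, collapse_fst] at hne
          exact hne hs
        rw [this]; simp
      · simp [PMF.pure_apply, hs]

lemma terminal_of_pathProb_ne_zero_of_le {π : S → PMF A} {s : S} {a₀ : A} {n : ℕ}
    {h : ℕ → S × A} (hn : M.pathProb π s a₀ n h ≠ 0) {t u : ℕ} (htu : t ≤ u) (hun : u ≤ n)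
    (ht : (h t).1 = M.terminal) : (h u).1 = M.terminal := by
  induction u, htu using Nat.le_induction with
  | base => exact ht
  | succ u _ ih => exact M.terminal_of_pathProb_ne_zero hn (by omega) (ih (by omega))

/-- A path of positive probability stays terminal after its length, so every later factor is `1` and
the product up to the horizon equals the product up to termination. -/
lemma toReal_prod_stepRatio_eq_isRatio {π b : S → PMF A} {s : S} {a₀ : A} {n : ℕ} {h : ℕ → S × A}
    (hn : M.pathProb b s a₀ n h ≠ 0) (ht : M.TerminatesBy n h) :
    (∏ t ∈ Finset.range (n + 1), M.stepRatio π b (h t)).toReal = M.isRatio π b h := by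
  rw [ENNReal.toReal_prod, isRatio, eq_comm]
  have hl := ht.length_le
  refine (Finset.prod_congr rfl fun t ht => ?_).trans
    (Finset.prod_subset (Finset.range_subset_range.2 (by omega)) fun t ht1 ht2 => ?_)
  · rw [stepRatio, if_neg (fst_ne_terminal_of_lt_length (Finset.mem_range.1 ht)),
      ENNReal.toReal_div]
  · rw [Finset.mem_range] at ht1 ht2
    rw [stepRatio, if_pos, ENNReal.toReal_one]
    exact M.terminal_of_pathProb_ne_zero_of_le hn (not_lt.1 ht2) (by omega)
      ht.terminates.fst_length

/-- The weight of a finite path under the policy `π`. -/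
def pathWeight (π : S → PMF A) (a₀ : A) (K : ℕ) (h : Fin (K + 1) → S × A) : ℝ :=
  (M.law π M.start).real {ω | M.truncate a₀ K ω = h}

lemma law_truncate_eq (π : S → PMF A) (s : S) (a₀ : A) (K : ℕ) (h : Fin (K + 1) → S × A) :
    M.law π s {ω | M.truncate a₀ K ω = h} = M.pathProb π s a₀ K (extendPath h) := by
  unfold pathProb
  congr 1
  ext ω
  simp only [Set.mem_ofPred_eq, funext_iff]
  constructor
  · intro H t ht
    have := H ⟨t, by omega⟩
    simp only [truncate] at this
    rw [this]; simp [extendPath, ht]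
  · intro H i
    have := H i (by omega)
    simp only [truncate]
    rw [this]
    have hi : min (i : ℕ) K = i := by omega
    simp [extendPath, hi]

lemma pathWeight_nonneg (π : S → PMF A) (a₀ : A) (K : ℕ) (h : Fin (K + 1) → S × A) :
    0 ≤ M.pathWeight π a₀ K h := measureReal_nonneg

lemma map_truncate_real_singleton (π : S → PMF A) (a₀ : A) (K : ℕ) (h : Fin (K + 1) → S × A) :
    ((M.law π M.start).map (M.truncate a₀ K)).real {h} = M.pathWeight π a₀ K h := by
  rw [map_measureReal_apply (M.measurable_truncate a₀ K) (MeasurableSet.of_discrete)]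
  rfl

/-- A property which holds almost surely holds for some trajectory through each path of positive
weight. -/
lemma exists_of_pathWeight_ne_zero {π : S → PMF A} {a₀ : A} {K : ℕ} {h : Fin (K + 1) → S × A}
    (hw : M.pathWeight π a₀ K h ≠ 0) {p : (ℕ → S × A) → Prop} (hp : ∀ᵐ ω ∂M.law π M.start, p ω) :
    ∃ ω, M.truncate a₀ K ω = h ∧ p ω := by
  by_contra! H
  apply hw
  rw [pathWeight, measureReal_def, measure_mono_null _ hp]
  · rfl
  · exact fun ω hω => H ω hω

/-- Failure to terminate by `K` is a finite union of collapsed path events. Each is null under `b`,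
hence null under `π` by the ratio formula. -/
lemma ae_terminatesBy {π b : S → PMF A} (a₀ : A) {K : ℕ} (hb : ∀ s a, b s a ≠ 0)
    (hK : ∀ᵐ ω ∂M.law b M.start, M.TerminatesBy K ω) :
    ∀ᵐ ω ∂M.law π M.start, M.TerminatesBy K ω := by
  have h1 : {ω | ¬ M.TerminatesBy K ω} ⊆ ⋃ h : {h : Fin (K + 1) → S × A //
      ¬ M.TerminatesBy K (extendPath h)}, {ω | M.truncate a₀ K ω = h} := by
    intro ω hω
    rw [Set.mem_iUnion]
    exact ⟨⟨M.truncate a₀ K ω, fun H => hω ((M.terminatesBy_extendPath_truncate a₀).1 H)⟩, rfl⟩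
  refine measure_mono_null h1 (measure_iUnion_null fun ⟨h, hh⟩ => ?_)
  change M.law π M.start {ω | M.truncate a₀ K ω = h} = 0
  rw [law_truncate_eq, M.pathProb_eq_mul_prod_stepRatio hb, ← law_truncate_eq,
    measure_mono_null _ hK, zero_mul]
  intro ω hω H
  apply hh
  rw [← show M.truncate a₀ K ω = h from hω]
  exact (M.terminatesBy_extendPath_truncate a₀).2 H

lemma pathWeight_eq_mul_isRatio {π b : S → PMF A} {a₀ : A} {K : ℕ} (hb : ∀ s a, b s a ≠ 0)
    (hK : ∀ᵐ ω ∂M.law b M.start, M.TerminatesBy K ω) (h : Fin (K + 1) → S × A) :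
    M.pathWeight π a₀ K h = M.pathWeight b a₀ K h * M.isRatio π b (extendPath h) := by
  by_cases hw : M.pathWeight b a₀ K h = 0
  · rw [hw, zero_mul]
    rw [pathWeight, measureReal_eq_zero_iff, law_truncate_eq] at hw
    rw [pathWeight, measureReal_def, law_truncate_eq, M.pathProb_eq_mul_prod_stepRatio hb, hw]
    simp
  · obtain ⟨ω, rfl, hω⟩ := M.exists_of_pathWeight_ne_zero hw hK
    have h0 : M.pathProb b M.start a₀ K (extendPath (M.truncate a₀ K ω)) ≠ 0 := by
      rw [← law_truncate_eq]
      intro h0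
      exact hw (by rw [pathWeight, measureReal_def, h0]; rfl)
    rw [pathWeight, pathWeight, measureReal_def, measureReal_def, law_truncate_eq,
      M.pathProb_eq_mul_prod_stepRatio hb, ENNReal.toReal_mul, law_truncate_eq,
      M.toReal_prod_stepRatio_eq_isRatio h0 ((M.terminatesBy_extendPath_truncate a₀).2 hω)]

lemma sum_pathWeight (π : S → PMF A) (a₀ : A) (K : ℕ) : ∑ h, M.pathWeight π a₀ K h = 1 := by
  have : IsProbabilityMeasure ((M.law π M.start).map (M.truncate a₀ K)) :=
    Measure.isProbabilityMeasure_map (M.measurable_truncate a₀ K).aemeasurable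
  simp_rw [← map_truncate_real_singleton]
  simp

open Classical in
/-- Importance sampling: the distribution function of the cumulative reward of `π` in terms of the
behavior policy `b`. -/
lemma rewardCDF_eq_sum {π b : S → PMF A} (a₀ : A) {K : ℕ} (hb : ∀ s a, b s a ≠ 0)
    (hK : ∀ᵐ ω ∂M.law b M.start, M.TerminatesBy K ω) (x : ℝ) :
    M.rewardCDF π x = ∑ h : Fin (K + 1) → S × A, if M.cumReward (extendPath h) ≤ x then
      M.pathWeight b a₀ K h * M.isRatio π b (extendPath h) else 0 := by
  simp_rw [← M.pathWeight_eq_mul_isRatio hb hK (π := π) (a₀ := a₀)]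
  have h1 : M.rewardCDF π x = (M.law π M.start).real
      (M.truncate a₀ K ⁻¹' {h | M.cumReward (extendPath h) ≤ x}) := by
    apply measureReal_congr
    filter_upwards [M.ae_terminatesBy a₀ hb hK (π := π)] with ω hω
    apply propext
    change M.cumReward ω ≤ x ↔ M.cumReward (extendPath (M.truncate a₀ K ω)) ≤ x
    rw [M.cumReward_extendPath_truncate a₀ hω]
  rw [h1, ← map_measureReal_apply (M.measurable_truncate a₀ K) (MeasurableSet.of_discrete),
    ← Finset.sum_filter]
  simp_rw [← map_truncate_real_singleton]
  rw [sum_measureReal_singleton, Finset.coe_filter_univ]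

end Law

end EpisodicMDP

/-! ### The derivative of a distortion function -/

open Set Filter Topology in
/-- The derivative of a function on `[0, 1]` which is continuous there, with bounded first and
second derivatives inside, extends to a Lipschitz function which is also the one-sided derivative at
the end points. -/
lemma exists_lipschitz_hasDerivWithinAt_Icc {g : ℝ → ℝ} (hg_cont : ContinuousOn g (Icc 0 1))
    (hg_diff : DifferentiableOn ℝ g (Ioo 0 1)) (hg_diff2 : DifferentiableOn ℝ (deriv g) (Ioo 0 1))
    {C₁ C₂ : ℝ} (h₁ : ∀ t ∈ Ioo (0 : ℝ) 1, |deriv g t| ≤ C₁)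
    (h₂ : ∀ t ∈ Ioo (0 : ℝ) 1, |deriv (deriv g) t| ≤ C₂) :
    ∃ G : ℝ → ℝ, (∀ x y, |G x - G y| ≤ C₂ * |x - y|) ∧ (∀ t ∈ Icc (0 : ℝ) 1, |G t| ≤ C₁) ∧
      ∀ t ∈ Icc (0 : ℝ) 1, HasDerivWithinAt g (G t) (Icc 0 1) t := by
  have hC₂ : 0 ≤ C₂ := (abs_nonneg _).trans (h₂ (1 / 2) (by norm_num))
  have hlip : LipschitzOnWith C₂.toNNReal (deriv g) (Ioo 0 1) := by
    refine LipschitzOnWith.of_dist_le_mul fun x hx y hy => ?_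
    rw [Real.coe_toNNReal _ hC₂, dist_eq_norm, dist_eq_norm]
    exact (convex_Ioo 0 1).norm_image_sub_le_of_norm_deriv_le
      (fun z hz => (hg_diff2 z hz).differentiableAt (isOpen_Ioo.mem_nhds hz)) h₂ hy hx
  -- Extending to the whole line makes the Lipschitz bound available without membership conditions;
  -- continuity fixes the values at `0` and `1`.
  obtain ⟨G, hG, hGeq⟩ := hlip.extend_real
  have hcl : Icc (0 : ℝ) 1 = closure (Ioo 0 1) := (closure_Ioo zero_ne_one).symm
  refine ⟨G, fun x y => ?_, fun t ht => ?_, fun t ht => ?_⟩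
  · simpa [Real.dist_eq, Real.coe_toNNReal _ hC₂] using hG.dist_le_mul x y
  · have hsub : closure (Ioo 0 1) ⊆ {t | |G t| ≤ C₁} := by
      refine closure_minimal (fun t ht => ?_) (isClosed_le hG.continuous.abs continuous_const)
      change |G t| ≤ C₁
      rw [← hGeq ht]
      exact h₁ t ht
    exact hsub (hcl ▸ ht)
  · rcases eq_or_lt_of_le ht.1 with h0 | h0
    · subst h0
      refine (hasDerivWithinAt_Ici_of_tendsto_deriv hg_diff ((hg_cont 0 ht).mono Ioo_subset_Icc_self)
        (Ioo_mem_nhdsGT zero_lt_one) ?_).mono Icc_subset_Ici_self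
      refine (hG.continuous.continuousAt.mono_left nhdsWithin_le_nhds).congr' ?_
      filter_upwards [Ioo_mem_nhdsGT (zero_lt_one' ℝ)] with z hz using (hGeq hz).symm
    rcases eq_or_lt_of_le ht.2 with h1 | h1
    · subst h1
      refine (hasDerivWithinAt_Iic_of_tendsto_deriv hg_diff ((hg_cont 1 ht).mono Ioo_subset_Icc_self)
        (Ioo_mem_nhdsLT zero_lt_one) ?_).mono Icc_subset_Iic_self
      refine (hG.continuous.continuousAt.mono_left nhdsWithin_le_nhds).congr' ?_
      filter_upwards [Ioo_mem_nhdsLT (zero_lt_one' ℝ)] with z hz using (hGeq hz).symm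
    · rw [← hGeq ⟨h0, h1⟩]
      exact (((hg_diff t ⟨h0, h1⟩).differentiableAt
        (Ioo_mem_nhds h0 h1)).hasDerivAt).hasDerivWithinAt

/-! ### Functions of a threshold pattern -/

section Pattern

variable {H V : Type*} [Fintype H] [NormedAddCommGroup V]

/-- All integrands in `x` below depend on `x` only through which thresholds `X h` it has passed.
There are finitely many such patterns, so no regularity of the outer function `Φ` is needed. -/
lemma stronglyMeasurable_pattern (X : H → ℝ) (Φ : (H → Prop) → V) :
    StronglyMeasurable fun x : ℝ => Φ fun h => X h ≤ x := by
  have h1 : Measurable fun x : ℝ => (fun h => X h ≤ x : H → Prop) :=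
    measurable_pi_lambda _ fun h => measurableSet_Ici.mem
  exact (StronglyMeasurable.of_discrete (f := Φ)).comp_measurable h1

lemma intervalIntegrable_pattern (X : H → ℝ) (Φ : (H → Prop) → V) (a b : ℝ) :
    IntervalIntegrable (fun x : ℝ => Φ fun h => X h ≤ x) volume a b := by
  have := Fintype.ofFinite (H → Prop)
  obtain ⟨C, hC⟩ : ∃ C, ∀ p, ‖Φ p‖ ≤ C :=
    ⟨∑ p, ‖Φ p‖, fun p => Finset.single_le_sum (f := fun p => ‖Φ p‖)
      (fun _ _ => norm_nonneg _) (Finset.mem_univ p)⟩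
  rw [intervalIntegrable_iff]
  exact Measure.integrableOn_of_bounded (by simp)
    (stronglyMeasurable_pattern X Φ).aestronglyMeasurable (ae_of_all _ fun x => hC _)

end Pattern

/-! ### A finite importance sampling model -/

/-- Finitely many episodes `h` of weight `w h` and reward `X h`, with likelihood ratios `ψ θ h` and
scores `sc θ h`, subject to uniform bounds on the episodes of nonzero weight. -/
structure ImportanceModel (H E : Type*) [Fintype H] [NormedAddCommGroup E] [InnerProductSpace ℝ E]
    [CompleteSpace E] where
  w : H → ℝ
  X : H → ℝ
  ψ : E → H → ℝ
  sc : E → H → E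
  Ms : ℝ
  B : ℝ
  C : ℝ
  w_nonneg : ∀ h, 0 ≤ w h
  sum_w : ∑ h, w h = 1
  sum_w_mul_ψ : ∀ θ, ∑ h, w h * ψ θ h = 1
  ψ_nonneg : ∀ θ h, 0 ≤ ψ θ h
  ψ_le : ∀ θ h, w h ≠ 0 → ψ θ h ≤ Ms
  hasGradientAt_ψ : ∀ θ h, HasGradientAt (ψ · h) (ψ θ h • sc θ h) θ
  norm_sc_le : ∀ θ h, w h ≠ 0 → ‖sc θ h‖ ≤ B
  differentiable_sc : ∀ h, Differentiable ℝ (sc · h)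
  norm_fderiv_sc_le : ∀ θ h, w h ≠ 0 → ‖fderiv ℝ (sc · h) θ‖ ≤ C

namespace ImportanceModel

variable {H E : Type*} [Fintype H] [NormedAddCommGroup E] [InnerProductSpace ℝ E]
    [CompleteSpace E] (m : ImportanceModel H E)

open Classical in
/-- The indicator of `X h ≤ x`. -/
def ind (x : ℝ) (h : H) : ℝ := if m.X h ≤ x then 1 else 0

lemma ind_nonneg (x : ℝ) (h : H) : 0 ≤ m.ind x h := by unfold ind; split_ifs <;> norm_num

lemma ind_le_one (x : ℝ) (h : H) : m.ind x h ≤ 1 := by unfold ind; split_ifs <;> norm_num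

/-- The distribution function of the reward. -/
def cdf (θ : E) (x : ℝ) : ℝ := ∑ h, (m.w h * m.ind x h) * m.ψ θ h

/-- The gradient in `θ` of the distribution function of the reward. -/
def cdfGrad (θ : E) (x : ℝ) : E := ∑ h, (m.w h * m.ind x h) • (m.ψ θ h • m.sc θ h)

lemma exists_w_ne_zero : ∃ h, m.w h ≠ 0 := by
  by_contra! H
  simpa [H] using m.sum_w

lemma B_nonneg : 0 ≤ m.B :=
  let ⟨h, hh⟩ := m.exists_w_ne_zero
  (norm_nonneg _).trans (m.norm_sc_le 0 h hh)

lemma C_nonneg : 0 ≤ m.C :=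
  let ⟨h, hh⟩ := m.exists_w_ne_zero
  (norm_nonneg _).trans (m.norm_fderiv_sc_le 0 h hh)

lemma one_le_Ms : 1 ≤ m.Ms := by
  calc (1 : ℝ) = ∑ h, m.w h * m.ψ 0 h := (m.sum_w_mul_ψ 0).symm
    _ ≤ ∑ h, m.w h * m.Ms := by
      refine Finset.sum_le_sum fun h _ => ?_
      by_cases hh : m.w h = 0
      · simp [hh]
      · exact mul_le_mul_of_nonneg_left (m.ψ_le 0 h hh) (m.w_nonneg h)
    _ = m.Ms := by rw [← Finset.sum_mul, m.sum_w, one_mul]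

/-- The numbers `w h * ψ θ h` form a probability vector. This is why the bounds on the exact
distribution function and its gradient do not involve `Ms`. -/
lemma norm_sum_smul_le {V : Type*} [NormedAddCommGroup V] [NormedSpace ℝ V] {f : H → V} {c : ℝ}
    (θ : E) (x : ℝ) (hf : ∀ h, m.w h ≠ 0 → ‖f h‖ ≤ m.ψ θ h * c) :
    ‖∑ h, (m.w h * m.ind x h) • f h‖ ≤ c := by
  calc ‖∑ h, (m.w h * m.ind x h) • f h‖ ≤ ∑ h, m.w h * m.ψ θ h * c := by
        refine (norm_sum_le _ _).trans (Finset.sum_le_sum fun h _ => ?_)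
        by_cases hh : m.w h = 0
        · simp [hh]
        rw [norm_smul, Real.norm_of_nonneg (mul_nonneg (m.w_nonneg h) (m.ind_nonneg x h))]
        calc m.w h * m.ind x h * ‖f h‖ ≤ m.w h * 1 * (m.ψ θ h * c) := by
              have := m.w_nonneg h
              have := m.ind_le_one x h
              gcongr
              exact hf h hh
          _ = _ := by ring
    _ = c := by rw [← Finset.sum_mul, m.sum_w_mul_ψ, one_mul]

lemma cdf_nonneg (θ : E) (x : ℝ) : 0 ≤ m.cdf θ x :=
  Finset.sum_nonneg fun h _ =>
    mul_nonneg (mul_nonneg (m.w_nonneg h) (m.ind_nonneg x h)) (m.ψ_nonneg θ h)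

lemma cdf_le_one (θ : E) (x : ℝ) : m.cdf θ x ≤ 1 :=
  (le_abs_self _).trans (m.norm_sum_smul_le (f := m.ψ θ) θ x fun h _ => by
    rw [Real.norm_of_nonneg (m.ψ_nonneg θ h), mul_one])

lemma one_sub_cdf_mem (θ : E) (x : ℝ) : 1 - m.cdf θ x ∈ Set.Icc (0 : ℝ) 1 :=
  ⟨by linarith [m.cdf_le_one θ x], by linarith [m.cdf_nonneg θ x]⟩

lemma norm_ψ_smul_sc_le (θ : E) {h : H} (hh : m.w h ≠ 0) :
    ‖m.ψ θ h • m.sc θ h‖ ≤ m.ψ θ h * m.B := by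
  rw [norm_smul, Real.norm_of_nonneg (m.ψ_nonneg θ h)]
  exact mul_le_mul_of_nonneg_left (m.norm_sc_le θ h hh) (m.ψ_nonneg θ h)

lemma norm_cdfGrad_le (θ : E) (x : ℝ) : ‖m.cdfGrad θ x‖ ≤ m.B :=
  m.norm_sum_smul_le θ x fun _ => m.norm_ψ_smul_sc_le θ

lemma hasFDerivAt_cdf (θ : E) (x : ℝ) :
    HasFDerivAt (m.cdf · x) (InnerProductSpace.toDual ℝ E (m.cdfGrad θ x)) θ := by
  have h1 : HasFDerivAt (m.cdf · x)
      (∑ h, (m.w h * m.ind x h) • InnerProductSpace.toDual ℝ E (m.ψ θ h • m.sc θ h)) θ := by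
    unfold cdf
    exact HasFDerivAt.fun_sum fun h _ => (m.hasGradientAt_ψ θ h).hasFDerivAt.const_mul _
  convert h1
  simp [cdfGrad, map_sum]

lemma abs_cdf_sub_le (x : ℝ) (θ θ' : E) : |m.cdf θ x - m.cdf θ' x| ≤ m.B * ‖θ - θ'‖ :=
  convex_univ.norm_image_sub_le_of_norm_hasFDerivWithin_le
    (fun θ _ => (m.hasFDerivAt_cdf θ x).hasFDerivWithinAt)
    (fun θ _ => by simpa using m.norm_cdfGrad_le θ x) (Set.mem_univ _) (Set.mem_univ _)

lemma norm_cdfGrad_sub_le (x : ℝ) (θ θ' : E) :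
    ‖m.cdfGrad θ x - m.cdfGrad θ' x‖ ≤ (m.C + m.B ^ 2) * ‖θ - θ'‖ := by
  -- Product rule: the derivative of `ψ sc` is `ψ` times `sc' + sc ⊗ sc`, whence the constant `C +
  -- B²`.
  have hd : ∀ θ, HasFDerivAt (m.cdfGrad · x) (∑ h, (m.w h * m.ind x h) •
      (m.ψ θ h • fderiv ℝ (m.sc · h) θ +
        (InnerProductSpace.toDual ℝ E (m.ψ θ h • m.sc θ h)).smulRight (m.sc θ h))) θ := by
    intro θ
    unfold cdfGrad
    exact HasFDerivAt.fun_sum fun h _ => ((m.hasGradientAt_ψ θ h).hasFDerivAt.fun_smul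
      (m.differentiable_sc h θ).hasFDerivAt).const_smul _
  refine convex_univ.norm_image_sub_le_of_norm_hasFDerivWithin_le
    (fun θ _ => (hd θ).hasFDerivWithinAt) (fun θ _ => ?_) (Set.mem_univ _) (Set.mem_univ _)
  refine m.norm_sum_smul_le θ x fun h hh => ?_
  refine (norm_add_le _ _).trans ?_
  rw [norm_smul, Real.norm_of_nonneg (m.ψ_nonneg θ h), ContinuousLinearMap.norm_smulRight_apply,
    LinearIsometryEquiv.norm_map]
  calc m.ψ θ h * ‖fderiv ℝ (m.sc · h) θ‖ + ‖m.ψ θ h • m.sc θ h‖ * ‖m.sc θ h‖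
      ≤ m.ψ θ h * m.C + m.ψ θ h * m.B * m.B := by
        have := m.ψ_nonneg θ h
        have := m.B_nonneg
        gcongr
        · exact m.norm_fderiv_sc_le θ h hh
        · exact m.norm_ψ_smul_sc_le θ hh
        · exact m.norm_sc_le θ h hh
    _ = _ := by ring

/-! ### Gradient of the risk measure and its Lipschitz constant -/

section Distortion

variable {g G : ℝ → ℝ} {C₁ C₂ Mr : ℝ}

/-- The gradient of the distortion risk measure. -/
def riskGrad (G : ℝ → ℝ) (Mr : ℝ) (θ : E) : E :=
  -∫ x in (-Mr)..Mr, G (1 - m.cdf θ x) • m.cdfGrad θ x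

lemma intervalIntegrable_riskGrad (θ : E) (a b : ℝ) :
    IntervalIntegrable (fun x => G (1 - m.cdf θ x) • m.cdfGrad θ x) volume a b := by
  classical
  exact intervalIntegrable_pattern m.X (fun p => G (1 - ∑ h, (m.w h * if p h then 1 else 0) *
    m.ψ θ h) • ∑ h, (m.w h * if p h then 1 else 0) • (m.ψ θ h • m.sc θ h)) _ _

lemma hasGradientAt_integral (hG₁ : ∀ t ∈ Set.Icc (0 : ℝ) 1, |G t| ≤ C₁)
    (hG : ∀ t ∈ Set.Icc (0 : ℝ) 1, HasDerivWithinAt g (G t) (Set.Icc 0 1) t) (θ : E) :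
    HasGradientAt (fun θ => ∫ x in (-Mr)..Mr, g (1 - m.cdf θ x)) (m.riskGrad G Mr θ) θ := by
  rw [hasGradientAt_iff_hasFDerivAt]
  classical
  set F' : E → ℝ → (E →L[ℝ] ℝ) := fun θ x =>
    G (1 - m.cdf θ x) • -InnerProductSpace.toDual ℝ E (m.cdfGrad θ x)
  have hF' : ∀ θ x, HasFDerivAt (fun θ => g (1 - m.cdf θ x)) (F' θ x) θ := by
    intro θ x
    rw [← hasFDerivWithinAt_univ]
    have h1 : HasFDerivWithinAt (fun θ => 1 - m.cdf θ x)
        (-InnerProductSpace.toDual ℝ E (m.cdfGrad θ x)) Set.univ θ :=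
      ((m.hasFDerivAt_cdf θ x).const_sub 1).hasFDerivWithinAt
    -- The inner function may take the values `0` and `1`, but it never leaves `[0, 1]`, so the
    -- one-sided derivative of `g` is enough for the chain rule.
    exact (hG _ (m.one_sub_cdf_mem θ x)).comp_hasFDerivWithinAt θ h1
      fun θ _ => m.one_sub_cdf_mem θ x
  have hb : ∀ θ x, ‖F' θ x‖ ≤ C₁ * m.B := by
    intro θ x
    rw [norm_smul, norm_neg, LinearIsometryEquiv.norm_map]
    exact mul_le_mul (hG₁ _ (m.one_sub_cdf_mem θ x)) (m.norm_cdfGrad_le θ x) (norm_nonneg _)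
      ((abs_nonneg _).trans (hG₁ _ (m.one_sub_cdf_mem θ x)))
  have hint : IntervalIntegrable (F' θ) volume (-Mr) Mr :=
    intervalIntegrable_pattern m.X (fun p => G (1 - ∑ h, (m.w h * if p h then 1 else 0) *
      m.ψ θ h) • -InnerProductSpace.toDual ℝ E (∑ h, (m.w h * if p h then 1 else 0) •
        (m.ψ θ h • m.sc θ h))) _ _
  have key := intervalIntegral.hasFDerivAt_integral_of_dominated_of_fderiv_le (𝕜 := ℝ)
    (μ := volume) (a := -Mr) (b := Mr) (F := fun θ x => g (1 - m.cdf θ x)) (F' := F')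
    (x₀ := θ) (s := Set.univ) (bound := fun _ => C₁ * m.B) Filter.univ_mem
    (Filter.Eventually.of_forall fun θ => ?_) ?_ ?_
    (ae_of_all _ fun x _ θ _ => hb θ x) (by simp) (ae_of_all _ fun x _ θ _ => hF' θ x)
  · suffices heq : InnerProductSpace.toDual ℝ E (m.riskGrad G Mr θ) = ∫ x in (-Mr)..Mr, F' θ x by
      rw [heq]
      exact key
    ext v
    rw [ContinuousLinearMap.intervalIntegral_apply hint, InnerProductSpace.toDual_apply_apply,
      riskGrad, real_inner_comm, inner_neg_right, ← innerSL_apply_apply ℝ,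
      ← ContinuousLinearMap.intervalIntegral_comp_comm _ (m.intervalIntegrable_riskGrad θ _ _),
      ← intervalIntegral.integral_neg]
    refine intervalIntegral.integral_congr fun x _ => ?_
    simp [F', real_inner_comm]
  · exact (stronglyMeasurable_pattern m.X fun p => g (1 - ∑ h, (m.w h * if p h then 1 else 0) *
      m.ψ θ h)).aestronglyMeasurable
  · exact intervalIntegrable_pattern m.X (fun p => g (1 - ∑ h, (m.w h * if p h then 1 else 0) *
      m.ψ θ h)) _ _
  · exact hint.def'.aestronglyMeasurable

lemma norm_riskGrad_le (hMr : 0 ≤ Mr) (hG₁ : ∀ t ∈ Set.Icc (0 : ℝ) 1, |G t| ≤ C₁) (θ : E) :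
    ‖m.riskGrad G Mr θ‖ ≤ 2 * Mr * C₁ * m.B := by
  rw [riskGrad, norm_neg]
  refine (intervalIntegral.norm_integral_le_of_norm_le_const (C := C₁ * m.B) fun x _ => ?_).trans ?_
  · rw [norm_smul]
    exact mul_le_mul (hG₁ _ (m.one_sub_cdf_mem θ x)) (m.norm_cdfGrad_le θ x) (norm_nonneg _)
      ((abs_nonneg _).trans (hG₁ _ (m.one_sub_cdf_mem θ x)))
  · rw [abs_of_nonneg (by linarith)]
    exact le_of_eq (by ring)

omit [CompleteSpace E] in
lemma norm_smul_sub_smul_le {a a' c ε : ℝ} {v v' : E} {δ B : ℝ} (ha : |a| ≤ c) (hε : |a - a'| ≤ ε)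
    (hδ : ‖v - v'‖ ≤ δ) (hB : ‖v'‖ ≤ B) : ‖a • v - a' • v'‖ ≤ c * δ + ε * B := by
  have h1 : a • v - a' • v' = a • (v - v') + (a - a') • v' := by
    rw [smul_sub, sub_smul]; abel
  rw [h1]
  refine (norm_add_le _ _).trans ?_
  rw [norm_smul, norm_smul]
  exact add_le_add (mul_le_mul ha hδ (norm_nonneg _) ((abs_nonneg _).trans ha))
    (mul_le_mul hε hB (norm_nonneg _) ((abs_nonneg _).trans hε))

lemma norm_riskGrad_sub_le (hMr : 0 ≤ Mr) (hG₁ : ∀ t ∈ Set.Icc (0 : ℝ) 1, |G t| ≤ C₁)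
    (hG₂ : ∀ x y, |G x - G y| ≤ C₂ * |x - y|) (θ θ' : E) :
    ‖m.riskGrad G Mr θ - m.riskGrad G Mr θ'‖ ≤
      2 * Mr * (C₁ * (m.C + m.B ^ 2) + C₂ * m.B ^ 2) * ‖θ - θ'‖ := by
  have hC₂ : 0 ≤ C₂ := by simpa using (abs_nonneg _).trans (hG₂ 1 0)
  rw [riskGrad, riskGrad, neg_sub_neg, norm_sub_rev, ← intervalIntegral.integral_sub
    (m.intervalIntegrable_riskGrad θ _ _) (m.intervalIntegrable_riskGrad θ' _ _)]
  refine (intervalIntegral.norm_integral_le_of_norm_le_const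
    (C := C₁ * ((m.C + m.B ^ 2) * ‖θ - θ'‖) + (C₂ * (m.B * ‖θ - θ'‖)) * m.B) fun x _ => ?_).trans ?_
  · refine norm_smul_sub_smul_le (hG₁ _ (m.one_sub_cdf_mem θ x)) ((hG₂ _ _).trans ?_)
      (m.norm_cdfGrad_sub_le x θ θ') (m.norm_cdfGrad_le θ' x)
    gcongr
    rw [sub_sub_sub_cancel_left, abs_sub_comm]
    exact m.abs_cdf_sub_le x θ θ'
  · rw [abs_of_nonneg (by linarith)]
    exact le_of_eq (by ring)

end Distortion

end ImportanceModel

/-! ### Random variables with finitely many values -/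

section FiniteValued

variable {Ω T V : Type*} [MeasurableSpace Ω] {P : Measure Ω} [MeasurableSpace T]
  [DiscreteMeasurableSpace T] [NormedAddCommGroup V]

lemma integrable_comp_of_finite [Finite T] [IsFiniteMeasure P] {X : Ω → T} (hX : Measurable X)
    (f : T → V) : Integrable (fun w => f (X w)) P :=
  (Integrable.of_finite (μ := P.map X) (f := f)).comp_measurable hX

variable [NormedSpace ℝ V]

lemma integral_comp_eq_sum [CompleteSpace V] [Fintype T] [IsFiniteMeasure P] {X : Ω → T} (hX : Measurable X)
    (f : T → V) : ∫ w, f (X w) ∂P = ∑ t, P.real {w | X w = t} • f t := by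
  rw [← integral_map hX.aemeasurable StronglyMeasurable.of_discrete.aestronglyMeasurable,
    integral_fintype .of_finite]
  refine Finset.sum_congr rfl fun t _ => ?_
  rw [map_measureReal_apply hX (MeasurableSet.of_discrete)]
  rfl

/-- Averaging over the second of two independent variables first. -/
lemma integral_le_of_indepFun {T' : Type*} [MeasurableSpace T'] [DiscreteMeasurableSpace T']
    [Finite T] [Finite T'] [IsProbabilityMeasure P] {X : Ω → T} {Y : Ω → T'} (hX : Measurable X)
    (hY : Measurable Y) (hXY : IndepFun X Y P) {f : T → T' → ℝ} {c : ℝ}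
    (hf : ∀ t, ∫ w, f t (Y w) ∂P ≤ c) : ∫ w, f (X w) (Y w) ∂P ≤ c := by
  have : IsProbabilityMeasure (P.map X) := Measure.isProbabilityMeasure_map hX.aemeasurable
  have : IsProbabilityMeasure (P.map Y) := Measure.isProbabilityMeasure_map hY.aemeasurable
  rw [← integral_map (φ := fun w => (X w, Y w)) (f := fun z => f z.1 z.2)
    (hX.prodMk hY).aemeasurable StronglyMeasurable.of_discrete.aestronglyMeasurable,
    (indepFun_iff_map_prod_eq_prod_map_map hX.aemeasurable hY.aemeasurable).1 hXY,
    integral_prod _ .of_finite]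
  refine (integral_mono .of_finite (integrable_const c) fun t => ?_).trans_eq (by simp)
  simp only
  rw [integral_map hY.aemeasurable StronglyMeasurable.of_discrete.aestronglyMeasurable]
  exact hf t

end FiniteValued

/-- The mean squared error of the average of `n` independent copies of a bounded vector. -/
lemma integral_norm_average_sub_sq_le {Ω H V : Type*} [MeasurableSpace Ω] {P : Measure Ω}
    [IsProbabilityMeasure P] [Fintype H] [MeasurableSpace H] [DiscreteMeasurableSpace H]
    [NormedAddCommGroup V] [InnerProductSpace ℝ V] [CompleteSpace V] {n : ℕ} (hn : 0 < n)
    {η : Fin n → Ω → H} (hη : ∀ i, Measurable (η i))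
    (hind : Pairwise fun i j => IndepFun (η i) (η j) P) {w : H → ℝ}
    (hlaw : ∀ i h, P.real {ω | η i ω = h} = w h) (f : H → V) {c : ℝ}
    (hf : ∀ h, w h ≠ 0 → ‖f h‖ ≤ c) :
    ∫ ω, ‖(1 / (n : ℝ)) • ∑ i, f (η i ω) - ∑ h, w h • f h‖ ^ 2 ∂P ≤ c ^ 2 / n := by
  set μ := ∑ h, w h • f h with hμ
  have hn' : (n : ℝ) ≠ 0 := by positivity
  have hw : ∑ h, w h = 1 := by
    have := integral_comp_eq_sum (P := P) (hη ⟨0, hn⟩) (fun _ => (1 : ℝ))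
    simpa [hlaw] using this.symm
  have hw0 : ∀ h, 0 ≤ w h := fun h => by rw [← hlaw ⟨0, hn⟩]; exact measureReal_nonneg
  set Y : H → V := fun h => f h - μ with hY
  have hY0 : ∀ i, ∫ ω, Y (η i ω) ∂P = 0 := by
    intro i
    rw [integral_comp_eq_sum (hη i)]
    simp_rw [hlaw, hY, smul_sub]
    rw [Finset.sum_sub_distrib, ← Finset.sum_smul, hw, one_smul, hμ, sub_self]
  have hint : ∀ i j, Integrable (fun ω => inner ℝ (Y (η i ω)) (Y (η j ω))) P := fun i j =>
    integrable_comp_of_finite ((hη i).prodMk (hη j)) fun z => inner ℝ (Y z.1) (Y z.2)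
  have hcross : ∀ i j, i ≠ j → ∫ ω, inner ℝ (Y (η i ω)) (Y (η j ω)) ∂P = 0 := by
    -- Independence lets the bilinear inner product commute with expectation, and the centred
    -- variables have mean zero.
    intro i j hij
    have := (hind hij).integral_bilin_comp_comp (f := Y) (g := Y) (hη i).aemeasurable
      (hη j).aemeasurable .of_finite .of_finite (innerSL ℝ (E := V))
    rw [hY0 i, map_zero, zero_apply] at this
    exact this
  have hdiag : ∀ i, ∫ ω, inner ℝ (Y (η i ω)) (Y (η i ω)) ∂P ≤ c ^ 2 := by
    intro i
    have h1 := integral_comp_eq_sum (P := P) (hη i) fun h => inner ℝ (Y h) (Y h)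
    rw [h1]
    simp_rw [hlaw, real_inner_self_eq_norm_sq, hY, smul_eq_mul, norm_sub_sq_real, mul_add, mul_sub]
    rw [Finset.sum_add_distrib, Finset.sum_sub_distrib, ← Finset.sum_mul, hw, one_mul]
    have h2 : ∑ h, w h * (2 * inner ℝ (f h) μ) = 2 * ‖μ‖ ^ 2 := by
      rw [← real_inner_self_eq_norm_sq]
      nth_rewrite 2 [hμ]
      rw [sum_inner, Finset.mul_sum]
      refine Finset.sum_congr rfl fun h _ => ?_
      rw [real_inner_smul_left]; ring
    have h3 : ∑ h, w h * ‖f h‖ ^ 2 ≤ ∑ h, w h * c ^ 2 := by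
      refine Finset.sum_le_sum fun h _ => ?_
      by_cases hh : w h = 0
      · simp [hh]
      · have := hw0 h
        have := hf h hh
        gcongr
    rw [← Finset.sum_mul, hw, one_mul] at h3
    rw [h2]
    nlinarith [sq_nonneg ‖μ‖]
  have hexp : ∀ ω, ‖(1 / (n : ℝ)) • ∑ i, f (η i ω) - μ‖ ^ 2 =
      (1 / (n : ℝ)) ^ 2 * ∑ i, ∑ j, inner ℝ (Y (η i ω)) (Y (η j ω)) := by
    intro ω
    have h1 : (1 / (n : ℝ)) • ∑ i, f (η i ω) - μ = (1 / (n : ℝ)) • ∑ i, Y (η i ω) := by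
      simp only [hY, Finset.sum_sub_distrib, smul_sub, Finset.sum_const, Finset.card_univ,
        Fintype.card_fin]
      rw [← Nat.cast_smul_eq_nsmul ℝ, smul_smul, one_div, inv_mul_cancel₀ hn', one_smul]
    rw [h1, norm_smul, mul_pow, Real.norm_eq_abs, sq_abs, ← real_inner_self_eq_norm_sq, sum_inner]
    simp_rw [inner_sum]
  simp_rw [hexp]
  rw [integral_const_mul, integral_finsetSum _ fun i _ => integrable_finsetSum _ fun j _ => hint i j]
  have h4 : ∀ i, ∫ ω, ∑ j, inner ℝ (Y (η i ω)) (Y (η j ω)) ∂P ≤ c ^ 2 := by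
    intro i
    rw [integral_finsetSum _ fun j _ => hint i j, Finset.sum_eq_single i
      (fun j _ hj => hcross i j hj.symm) (by simp)]
    exact hdiag i
  calc (1 / (n : ℝ)) ^ 2 * ∑ i, ∫ ω, ∑ j, inner ℝ (Y (η i ω)) (Y (η j ω)) ∂P
      ≤ (1 / (n : ℝ)) ^ 2 * ∑ _i : Fin n, c ^ 2 := by
        gcongr with i
        exact h4 i
    _ = c ^ 2 / n := by
        simp only [Finset.sum_const, Finset.card_univ, Fintype.card_fin, nsmul_eq_mul]
        field_simp

/-- The Cauchy-Schwarz inequality on a symmetric interval. -/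
lemma sq_intervalIntegral_le {φ : ℝ → ℝ} {r : ℝ} (hr : 0 < r)
    (h1 : IntervalIntegrable φ volume (-r) r)
    (h2 : IntervalIntegrable (fun x => φ x ^ 2) volume (-r) r) :
    (∫ x in (-r)..r, φ x) ^ 2 ≤ 2 * r * ∫ x in (-r)..r, φ x ^ 2 := by
  set I := ∫ x in (-r)..r, φ x with hI
  set J := ∫ x in (-r)..r, φ x ^ 2 with hJ
  -- `I / (2r)` is the mean of `φ`; expanding the nonnegative variance gives the inequality.
  have h3 : 0 ≤ ∫ x in (-r)..r, (2 * r * φ x - I) ^ 2 :=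
    intervalIntegral.integral_nonneg (by linarith) fun x _ => sq_nonneg _
  have h4 : ∫ x in (-r)..r, (2 * r * φ x - I) ^ 2 = 4 * r ^ 2 * J - 4 * r * I * I + 2 * r * I ^ 2 := by
    have h5 : ∀ x, (2 * r * φ x - I) ^ 2 = 4 * r ^ 2 * φ x ^ 2 - 4 * r * I * φ x + I ^ 2 :=
      fun x => by ring
    simp_rw [h5]
    rw [intervalIntegral.integral_add ((h2.const_mul _).sub (h1.const_mul _)) (by simp),
      intervalIntegral.integral_sub (h2.const_mul _) (h1.const_mul _),
      intervalIntegral.integral_const_mul, intervalIntegral.integral_const_mul, ← hI, ← hJ,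
      intervalIntegral.integral_const, smul_eq_mul]
    ring
  rw [h4] at h3
  have h5 : 0 ≤ (2 * r) * (2 * r * J - I ^ 2) := by linarith
  linarith [nonneg_of_mul_nonneg_right h5 (by linarith)]

/-! ### Mean squared error of the gradient estimate in the finite model -/

namespace ImportanceModel

variable {H E : Type*} [Fintype H] [NormedAddCommGroup E] [InnerProductSpace ℝ E]
    [CompleteSpace E] (m : ImportanceModel H E) {n : ℕ}

/-- The estimate of the distribution function from a batch of `n` episodes, capped at `1`. -/
def cdfEst (θ : E) (η : Fin n → H) (x : ℝ) : ℝ :=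
  min ((1 / (n : ℝ)) * ∑ i, m.ind x (η i) * m.ψ θ (η i)) 1

/-- The estimate of the gradient of the distribution function. -/
def cdfGradEst (θ : E) (η : Fin n → H) (x : ℝ) : E :=
  (1 / (n : ℝ)) • ∑ i, m.ind x (η i) • (m.ψ θ (η i) • m.sc θ (η i))

/-- The estimate of the gradient of the distortion risk measure. -/
def riskGradEst (G : ℝ → ℝ) (Mr : ℝ) (θ : E) (η : Fin n → H) : E :=
  -∫ x in (-Mr)..Mr, G (1 - m.cdfEst θ η x) • m.cdfGradEst θ η x

lemma one_sub_cdfEst_mem (θ : E) (η : Fin n → H) (x : ℝ) :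
    1 - m.cdfEst θ η x ∈ Set.Icc (0 : ℝ) 1 := by
  have h1 : m.cdfEst θ η x ≤ 1 := min_le_right _ _
  have h2 : 0 ≤ m.cdfEst θ η x := le_min (mul_nonneg (by positivity)
    (Finset.sum_nonneg fun i _ => mul_nonneg (m.ind_nonneg _ _) (m.ψ_nonneg _ _))) zero_le_one
  exact ⟨by linarith, by linarith⟩

lemma norm_ind_smul_le (θ : E) (x : ℝ) {h : H} (hh : m.w h ≠ 0) :
    ‖m.ind x h • (m.ψ θ h • m.sc θ h)‖ ≤ m.Ms * m.B := by
  rw [norm_smul, Real.norm_of_nonneg (m.ind_nonneg x h)]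
  have h1 : ‖m.ψ θ h • m.sc θ h‖ ≤ m.Ms * m.B :=
    (m.norm_ψ_smul_sc_le θ hh).trans (mul_le_mul_of_nonneg_right (m.ψ_le θ h hh) m.B_nonneg)
  exact (mul_le_of_le_one_left (norm_nonneg _) (m.ind_le_one x h)).trans h1

lemma norm_cdfGradEst_le (hn : 0 < n) (θ : E) {η : Fin n → H} (hη : ∀ i, m.w (η i) ≠ 0) (x : ℝ) :
    ‖m.cdfGradEst θ η x‖ ≤ m.Ms * m.B := by
  have hn' : (n : ℝ) ≠ 0 := by positivity
  rw [cdfGradEst, norm_smul, Real.norm_of_nonneg (by positivity)]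
  calc 1 / (n : ℝ) * ‖∑ i, m.ind x (η i) • (m.ψ θ (η i) • m.sc θ (η i))‖
      ≤ 1 / (n : ℝ) * ∑ _i : Fin n, m.Ms * m.B := by
        gcongr
        exact norm_sum_le_of_le _ fun i _ => m.norm_ind_smul_le θ x (hη i)
    _ = _ := by
        simp only [Finset.sum_const, Finset.card_univ, Fintype.card_fin, nsmul_eq_mul]
        field_simp

section Distortion

variable {G : ℝ → ℝ} {C₁ C₂ Mr : ℝ}

lemma norm_riskGradEst_le (hMr : 0 ≤ Mr) (hG₁ : ∀ t ∈ Set.Icc (0 : ℝ) 1, |G t| ≤ C₁) (hn : 0 < n)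
    (θ : E) {η : Fin n → H} (hη : ∀ i, m.w (η i) ≠ 0) :
    ‖m.riskGradEst G Mr θ η‖ ≤ 2 * Mr * C₁ * (m.Ms * m.B) := by
  rw [riskGradEst, norm_neg]
  refine (intervalIntegral.norm_integral_le_of_norm_le_const (C := C₁ * (m.Ms * m.B))
    fun x _ => ?_).trans ?_
  · rw [norm_smul]
    exact mul_le_mul (hG₁ _ (m.one_sub_cdfEst_mem θ η x)) (m.norm_cdfGradEst_le hn θ hη x)
      (norm_nonneg _) ((abs_nonneg _).trans (hG₁ _ (m.one_sub_cdfEst_mem θ η x)))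
  · rw [abs_of_nonneg (by linarith)]
    exact le_of_eq (by ring)

variable {Ω : Type*} [MeasurableSpace Ω] {P : Measure Ω} [IsProbabilityMeasure P]
  [MeasurableSpace H] [DiscreteMeasurableSpace H] {η : Fin n → Ω → H}

/-- The pointwise error of the integrand of the gradient estimate. -/
def integrandError (G : ℝ → ℝ) (θ : E) (η : Fin n → H) (x : ℝ) : E :=
  G (1 - m.cdfEst θ η x) • m.cdfGradEst θ η x - G (1 - m.cdf θ x) • m.cdfGrad θ x

-- The error splits into that of the gradient factor, weighted by the bound on `G`, and that of the
-- distribution function, weighted by the Lipschitz constant of `G`. Capping at `1` does no harm: it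
-- is nonexpansive and fixes the true value.
omit [MeasurableSpace H] [DiscreteMeasurableSpace H] in
lemma norm_integrandError_sq_le (hG₁ : ∀ t ∈ Set.Icc (0 : ℝ) 1, |G t| ≤ C₁)
    (hG₂ : ∀ x y, |G x - G y| ≤ C₂ * |x - y|) (θ : E) (η : Fin n → H) (x : ℝ) :
    ‖m.integrandError G θ η x‖ ^ 2 ≤ 2 * C₁ ^ 2 * ‖m.cdfGradEst θ η x - m.cdfGrad θ x‖ ^ 2 +
      2 * C₂ ^ 2 * m.B ^ 2 *
        ‖(1 / (n : ℝ)) • ∑ i, m.ind x (η i) * m.ψ θ (η i) - m.cdf θ x‖ ^ 2 := by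
  have hC₂ : 0 ≤ C₂ := by simpa using (abs_nonneg _).trans (hG₂ 1 0)
  set δ := ‖m.cdfGradEst θ η x - m.cdfGrad θ x‖
  set ε := ‖(1 / (n : ℝ)) • ∑ i, m.ind x (η i) * m.ψ θ (η i) - m.cdf θ x‖
  have h1 : |m.cdfEst θ η x - m.cdf θ x| ≤ ε := by
    have : m.cdf θ x = min (m.cdf θ x) 1 := (min_eq_left (m.cdf_le_one θ x)).symm
    rw [this]
    exact abs_inf_sub_inf_le_abs _ _ _
  have h2 : ‖m.integrandError G θ η x‖ ≤ C₁ * δ + C₂ * ε * m.B := by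
    refine norm_smul_sub_smul_le (hG₁ _ (m.one_sub_cdfEst_mem θ η x)) ((hG₂ _ _).trans ?_) le_rfl
      (m.norm_cdfGrad_le θ x)
    rw [sub_sub_sub_cancel_left, abs_sub_comm]
    gcongr
  calc ‖m.integrandError G θ η x‖ ^ 2 ≤ (C₁ * δ + C₂ * ε * m.B) ^ 2 := by gcongr
    _ ≤ _ := by nlinarith [sq_nonneg (C₁ * δ - C₂ * ε * m.B)]

lemma integral_norm_integrandError_sq_le (hG₁ : ∀ t ∈ Set.Icc (0 : ℝ) 1, |G t| ≤ C₁)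
    (hG₂ : ∀ x y, |G x - G y| ≤ C₂ * |x - y|) (hn : 0 < n) (hη : ∀ i, Measurable (η i))
    (hind : Pairwise fun i j => IndepFun (η i) (η j) P)
    (hlaw : ∀ i h, P.real {ω | η i ω = h} = m.w h) (θ : E) (x : ℝ) :
    ∫ ω, ‖m.integrandError G θ (fun i => η i ω) x‖ ^ 2 ∂P ≤
      2 * m.Ms ^ 2 * m.B ^ 2 * (C₁ ^ 2 + C₂ ^ 2) / n := by
  have hη' : Measurable fun ω i => η i ω := measurable_pi_lambda _ hη
  have h1 := integral_norm_average_sub_sq_le hn hη hind hlaw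
    (fun h => m.ind x h • (m.ψ θ h • m.sc θ h)) fun h hh => m.norm_ind_smul_le θ x hh
  have h2 := integral_norm_average_sub_sq_le hn hη hind hlaw
    (fun h => m.ind x h * m.ψ θ h) (c := m.Ms) fun h hh => by
      rw [Real.norm_of_nonneg (mul_nonneg (m.ind_nonneg _ _) (m.ψ_nonneg _ _))]
      exact (mul_le_of_le_one_left (m.ψ_nonneg _ _) (m.ind_le_one x h)).trans (m.ψ_le θ h hh)
  have e1 : ∑ h, m.w h • (m.ind x h • (m.ψ θ h • m.sc θ h)) = m.cdfGrad θ x := by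
    simp_rw [cdfGrad, mul_smul]
  have e2 : ∑ h, m.w h • (m.ind x h * m.ψ θ h) = m.cdf θ x := by
    simp_rw [cdf, smul_eq_mul, mul_assoc]
  rw [e1] at h1
  rw [e2] at h2
  refine (integral_mono (integrable_comp_of_finite hη' fun z => ‖m.integrandError G θ z x‖ ^ 2)
    (((integrable_comp_of_finite hη' fun z => ‖m.cdfGradEst θ z x - m.cdfGrad θ x‖ ^ 2).const_mul
      (2 * C₁ ^ 2)).add ((integrable_comp_of_finite hη' fun z =>
        ‖(1 / (n : ℝ)) • ∑ i, m.ind x (z i) * m.ψ θ (z i) - m.cdf θ x‖ ^ 2).const_mul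
          (2 * C₂ ^ 2 * m.B ^ 2))) fun ω => m.norm_integrandError_sq_le hG₁ hG₂ θ _ x).trans ?_
  simp only [Pi.add_apply]
  rw [integral_add ((integrable_comp_of_finite hη' fun z =>
      ‖m.cdfGradEst θ z x - m.cdfGrad θ x‖ ^ 2).const_mul _)
      ((integrable_comp_of_finite hη' fun z =>
        ‖(1 / (n : ℝ)) • ∑ i, m.ind x (z i) * m.ψ θ (z i) - m.cdf θ x‖ ^ 2).const_mul _),
    integral_const_mul, integral_const_mul]
  refine (add_le_add (mul_le_mul_of_nonneg_left h1 (by positivity))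
    (mul_le_mul_of_nonneg_left h2 (by positivity))).trans_eq ?_
  ring

/-- The mean squared error of the gradient estimate. -/
lemma integral_norm_riskGradEst_sub_sq_le (hMr : 0 < Mr)
    (hG₁ : ∀ t ∈ Set.Icc (0 : ℝ) 1, |G t| ≤ C₁)
    (hG₂ : ∀ x y, |G x - G y| ≤ C₂ * |x - y|) (hn : 0 < n) (hη : ∀ i, Measurable (η i))
    (hind : Pairwise fun i j => IndepFun (η i) (η j) P)
    (hlaw : ∀ i h, P.real {ω | η i ω = h} = m.w h) (θ : E) :
    ∫ ω, ‖m.riskGradEst G Mr θ (fun i => η i ω) - m.riskGrad G Mr θ‖ ^ 2 ∂P ≤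
      8 * Mr ^ 2 * m.Ms ^ 2 * m.B ^ 2 * (C₁ ^ 2 + C₂ ^ 2) / n := by
  classical
  have hη' : Measurable fun ω i => η i ω := measurable_pi_lambda _ hη
  have hpat : ∀ z : Fin n → H, ∃ Φ : (H → Prop) → E,
      (m.integrandError G θ z) = fun x => Φ fun h => m.X h ≤ x := fun z =>
    ⟨fun p => G (1 - min ((1 / (n : ℝ)) * ∑ i, (if p (z i) then 1 else 0) * m.ψ θ (z i)) 1) •
      ((1 / (n : ℝ)) • ∑ i, (if p (z i) then (1 : ℝ) else 0) • (m.ψ θ (z i) • m.sc θ (z i))) -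
      G (1 - ∑ h, (m.w h * if p h then 1 else 0) * m.ψ θ h) •
        ∑ h, (m.w h * if p h then 1 else 0) • (m.ψ θ h • m.sc θ h), rfl⟩
  have hint : ∀ z : Fin n → H, IntervalIntegrable (fun x => ‖m.integrandError G θ z x‖) volume
      (-Mr) Mr := fun z => by
    obtain ⟨Φ, hΦ⟩ := hpat z
    simp_rw [hΦ]
    exact intervalIntegrable_pattern m.X (fun p => ‖Φ p‖) _ _
  have hint2 : ∀ z : Fin n → H, IntervalIntegrable (fun x => ‖m.integrandError G θ z x‖ ^ 2) volume
      (-Mr) Mr := fun z => by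
    obtain ⟨Φ, hΦ⟩ := hpat z
    simp_rw [hΦ]
    exact intervalIntegrable_pattern m.X (fun p => ‖Φ p‖ ^ 2) _ _
  have h1 : ∀ z : Fin n → H, ‖m.riskGradEst G Mr θ z - m.riskGrad G Mr θ‖ ^ 2 ≤
      2 * Mr * ∫ x in (-Mr)..Mr, ‖m.integrandError G θ z x‖ ^ 2 := by
    intro z
    refine le_trans ?_ (sq_intervalIntegral_le hMr (hint z) (hint2 z))
    gcongr
    have h2 : IntervalIntegrable (fun x => G (1 - m.cdfEst θ z x) • m.cdfGradEst θ z x) volume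
        (-Mr) Mr :=
      intervalIntegrable_pattern m.X (fun p =>
        G (1 - min ((1 / (n : ℝ)) * ∑ i, (if p (z i) then 1 else 0) * m.ψ θ (z i)) 1) •
        ((1 / (n : ℝ)) • ∑ i, (if p (z i) then (1 : ℝ) else 0) • (m.ψ θ (z i) • m.sc θ (z i)))) _ _
    rw [riskGradEst, riskGrad, neg_sub_neg, norm_sub_rev, ← intervalIntegral.integral_sub h2
      (m.intervalIntegrable_riskGrad θ _ _)]
    exact intervalIntegral.norm_integral_le_integral_norm (by linarith)
  refine (integral_mono (integrable_comp_of_finite hη' fun z =>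
    ‖m.riskGradEst G Mr θ z - m.riskGrad G Mr θ‖ ^ 2) (integrable_comp_of_finite hη' fun z =>
      2 * Mr * ∫ x in (-Mr)..Mr, ‖m.integrandError G θ z x‖ ^ 2) fun ω => h1 _).trans ?_
  rw [integral_const_mul, integral_comp_eq_sum hη' fun z =>
    ∫ x in (-Mr)..Mr, ‖m.integrandError G θ z x‖ ^ 2]
  simp_rw [← intervalIntegral.integral_smul]
  have hint3 : ∀ z : Fin n → H, IntervalIntegrable (fun x =>
      P.real {ω | (fun i => η i ω) = z} • ‖m.integrandError G θ z x‖ ^ 2) volume (-Mr) Mr :=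
    fun z => (hint2 z).const_mul _
  -- The expectation is a finite sum, so exchanging it with the integral in `x` is mere linearity.
  rw [← intervalIntegral.integral_finsetSum fun z _ => hint3 z]
  have h3 : ∫ x in (-Mr)..Mr, ∑ z : Fin n → H, P.real {ω | (fun i => η i ω) = z} •
      ‖m.integrandError G θ z x‖ ^ 2 ≤
      ∫ _x in (-Mr)..Mr, 2 * m.Ms ^ 2 * m.B ^ 2 * (C₁ ^ 2 + C₂ ^ 2) / n := by
    have hint4 := IntervalIntegrable.sum Finset.univ fun z _ => hint3 z
    rw [Finset.sum_fn] at hint4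
    refine intervalIntegral.integral_mono_on (by linarith) hint4 (by simp) fun x _ => ?_
    rw [← integral_comp_eq_sum hη' fun z => ‖m.integrandError G θ z x‖ ^ 2]
    exact m.integral_norm_integrandError_sq_le hG₁ hG₂ hn hη hind hlaw θ x
  rw [intervalIntegral.integral_const, smul_eq_mul] at h3
  refine (mul_le_mul_of_nonneg_left h3 (by linarith)).trans_eq ?_
  ring

end Distortion

end ImportanceModel

lemma ae_mem_Icc_of_uniform {Ω : Type*} [MeasurableSpace Ω] {P : Measure Ω}
    [IsProbabilityMeasure P] {N : ℕ} (hN : 0 < N) {R : Ω → ℕ} (hR : Measurable R)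
    (hRlaw : ∀ k ∈ Finset.Icc 1 N, P {w | R w = k} = (N : ENNReal)⁻¹) :
    ∀ᵐ w ∂P, R w ∈ Finset.Icc 1 N := by
  have h1 : P (R ⁻¹' ↑(Finset.Icc 1 N)) = 1 := by
    rw [← sum_measure_preimage_singleton _ fun k _ => hR (measurableSet_singleton k)]
    have : ∀ k ∈ Finset.Icc 1 N, P (R ⁻¹' {k}) = (N : ENNReal)⁻¹ := hRlaw
    rw [Finset.sum_congr rfl this, Finset.sum_const, Nat.card_Icc, Nat.add_sub_cancel,
      nsmul_eq_mul, ENNReal.mul_inv_cancel (by exact_mod_cast hN.ne') (ENNReal.natCast_ne_top N)]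
  exact (prob_compl_eq_zero_iff (hR (Finset.measurableSet _))).2 h1

/-! ### Stochastic gradient ascent with a biased gradient estimate -/

section Ascent

variable {E : Type*} [NormedAddCommGroup E] [InnerProductSpace ℝ E] [CompleteSpace E]
  {ρ : E → ℝ} {D : E → E} {L : ℝ}

/-- The ascent lemma for functions with Lipschitz gradient. -/
lemma le_apply_add_of_lipschitz_gradient (hD : ∀ θ, HasGradientAt ρ (D θ) θ)
    (hL : ∀ θ θ', ‖D θ - D θ'‖ ≤ L * ‖θ - θ'‖) (θ v : E) :
    ρ θ + inner ℝ (D θ) v - L / 2 * ‖v‖ ^ 2 ≤ ρ (θ + v) := by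
  -- The quadratic term compensates exactly for the possible drop of the gradient along the segment,
  -- so `φ` is nondecreasing; compare its values at `0` and `1`.
  set φ : ℝ → ℝ := fun t => ρ (θ + t • v) - t * inner ℝ (D θ) v + L / 2 * t ^ 2 * ‖v‖ ^ 2 with hφ
  have hd : ∀ t, HasDerivAt φ
      (inner ℝ (D (θ + t • v)) v - 1 * inner ℝ (D θ) v + L / 2 * (2 * t) * ‖v‖ ^ 2) t := by
    intro t
    have h1 : HasDerivAt (fun t : ℝ => θ + t • v) v t := by
      simpa using ((hasDerivAt_id t).smul_const v).const_add θ
    have h2 : HasDerivAt (fun t : ℝ => ρ (θ + t • v)) (inner ℝ (D (θ + t • v)) v) t := by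
      exact (hD (θ + t • v)).hasFDerivAt.comp_hasDerivAt t h1
    have h3 : HasDerivAt (fun t : ℝ => t ^ 2) (2 * t) t := by simpa using hasDerivAt_pow 2 t
    exact (h2.sub ((hasDerivAt_id t).mul_const _)).add ((h3.const_mul (L / 2)).mul_const _)
  have hmono : MonotoneOn φ (Set.Icc 0 1) := by
    refine monotoneOn_of_deriv_nonneg (convex_Icc 0 1)
      (fun t _ => (hd t).continuousAt.continuousWithinAt)
      (fun t _ => (hd t).differentiableAt.differentiableWithinAt) fun t ht => ?_
    rw [interior_Icc] at ht
    rw [(hd t).deriv]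
    have h4 : -(L * (t * ‖v‖) * ‖v‖) ≤ inner ℝ (D (θ + t • v) - D θ) v := by
      have h5 := hL (θ + t • v) θ
      rw [add_sub_cancel_left, norm_smul, Real.norm_of_nonneg ht.1.le] at h5
      have h6 := abs_le.1 (abs_real_inner_le_norm (D (θ + t • v) - D θ) v)
      have h7 := mul_le_mul_of_nonneg_right h5 (norm_nonneg v)
      linarith [h6.1]
    rw [inner_sub_left] at h4
    nlinarith
  have h := hmono (Set.left_mem_Icc.2 zero_le_one) (Set.right_mem_Icc.2 zero_le_one) zero_le_one
  simp only [hφ] at h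
  norm_num at h
  linarith

/-- Polarization replaces the inner product of gradient and estimate by squared norms, so any bias
enters only through the squared error. -/
lemma half_norm_sq_le_of_ascent (hD : ∀ θ, HasGradientAt ρ (D θ) θ)
    (hL : ∀ θ θ', ‖D θ - D θ'‖ ≤ L * ‖θ - θ'‖) {α : ℝ} (hα : 0 ≤ α) (θ u : E) :
    α / 2 * ‖D θ‖ ^ 2 ≤
      ρ (θ + α • u) - ρ θ + α / 2 * ‖u - D θ‖ ^ 2 + L / 2 * α ^ 2 * ‖u‖ ^ 2 := by
  have h1 := le_apply_add_of_lipschitz_gradient hD hL θ (α • u)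
  rw [norm_smul, mul_pow, Real.norm_eq_abs, sq_abs, real_inner_smul_right] at h1
  have h2 : ‖u - D θ‖ ^ 2 = ‖u‖ ^ 2 - 2 * inner ℝ (D θ) u + ‖D θ‖ ^ 2 := by
    rw [norm_sub_sq_real, real_inner_comm]
  have h3 : 0 ≤ α / 2 * ‖u‖ ^ 2 := by positivity
  rw [h2]
  linarith

/-- The iterates `θ_{k+1} = θ_k + α e(θ_k, z_k)`. -/
def ascentIterate {T : Type*} (e : E → T → E) (α : ℝ) (θ₀ : E) (z : ℕ → T) : ℕ → E
  | 0 => θ₀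
  | k + 1 => ascentIterate e α θ₀ z k + α • e (ascentIterate e α θ₀ z k) (z k)

omit [CompleteSpace E] in
lemma ascentIterate_congr {T T' : Type*} {e : E → T → E} {e' : E → T' → E} {α : ℝ} {θ₀ : E}
    {z : ℕ → T} {z' : ℕ → T'} {k : ℕ} (h : ∀ j < k, ∀ θ, e θ (z j) = e' θ (z' j)) :
    ascentIterate e α θ₀ z k = ascentIterate e' α θ₀ z' k := by
  induction k with
  | zero => rfl
  | succ k ih =>
    rw [ascentIterate, ascentIterate, ih fun j hj => h j (by omega), h k (by omega)]

omit [CompleteSpace E] in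
-- An iterate uses only earlier samples, so it factors through finitely many of them. This gives
-- integrability, and independence from the next batch.
lemma exists_ascentIterate_eq {T : Type*} [Nonempty T] (e : E → T → E) (α : ℝ) (θ₀ : E) {k n : ℕ}
    (hkn : k ≤ n) : ∃ Θ : (Fin n → T) → E, ∀ z : ℕ → T,
      ascentIterate e α θ₀ z k = Θ fun j => z j := by
  refine ⟨fun p => ascentIterate e α θ₀
    (fun j => if h : j < n then p ⟨j, h⟩ else Classical.arbitrary T) k, fun z => ?_⟩
  refine ascentIterate_congr fun j hj θ => ?_
  rw [dif_pos (hj.trans_le hkn)]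

variable {Ω T : Type*} [MeasurableSpace Ω] {P : Measure Ω} [IsProbabilityMeasure P] [Finite T]
  [MeasurableSpace T] [DiscreteMeasurableSpace T] {e : E → T → E} {α : ℝ} {θ₀ : E} {N : ℕ}
  {ζ : ℕ → Ω → T}

omit [CompleteSpace E] in
lemma integrable_ascentIterate [Nonempty T] (hζ : ∀ k < N, Measurable (ζ k)) (f : E → ℝ) {k : ℕ}
    (hk : k ≤ N) : Integrable (fun w => f (ascentIterate e α θ₀ (fun j => ζ j w) k)) P := by
  obtain ⟨Θ, hΘ⟩ := exists_ascentIterate_eq e α θ₀ hk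
  simp_rw [hΘ]
  exact integrable_comp_of_finite (measurable_pi_lambda _ fun j : Fin N => hζ j j.2) fun p => f (Θ p)

/-- The expected progress in one step. -/
lemma integral_norm_sq_ascentIterate_le [Nonempty T] (hD : ∀ θ, HasGradientAt ρ (D θ) θ)
    (hL0 : 0 ≤ L) (hL : ∀ θ θ', ‖D θ - D θ'‖ ≤ L * ‖θ - θ'‖) (hα : 0 ≤ α)
    (hζ : ∀ k < N, Measurable (ζ k))
    (hind : ∀ k < N, IndepFun (fun w (j : Fin k) => ζ j w) (ζ k) P) {Q V : ℝ}
    (hQ : ∀ k < N, ∀ᵐ w ∂P, ∀ θ, ‖e θ (ζ k w)‖ ≤ Q)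
    (hV : ∀ k < N, ∀ θ, ∫ w, ‖e θ (ζ k w) - D θ‖ ^ 2 ∂P ≤ V) {k : ℕ} (hk : k < N) :
    α / 2 * ∫ w, ‖D (ascentIterate e α θ₀ (fun j => ζ j w) k)‖ ^ 2 ∂P ≤
      ∫ w, ρ (ascentIterate e α θ₀ (fun j => ζ j w) (k + 1)) ∂P -
      ∫ w, ρ (ascentIterate e α θ₀ (fun j => ζ j w) k) ∂P +
      (α / 2 * V + L / 2 * α ^ 2 * Q ^ 2) := by
  obtain ⟨Θ, hΘ⟩ := exists_ascentIterate_eq e α θ₀ (le_refl k)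
  have hX : Measurable fun w (j : Fin k) => ζ j w :=
    measurable_pi_lambda _ fun j => hζ j (j.2.trans hk)
  have herr : ∫ w, ‖e (ascentIterate e α θ₀ (fun j => ζ j w) k) (ζ k w) -
      D (ascentIterate e α θ₀ (fun j => ζ j w) k)‖ ^ 2 ∂P ≤ V := by
    simp_rw [hΘ]
    -- The current iterate is independent of the fresh batch, so the error bound at a fixed
    -- parameter applies conditionally on the past.
    exact integral_le_of_indepFun hX (hζ k hk) (hind k hk)
      (f := fun p t => ‖e (Θ p) t - D (Θ p)‖ ^ 2) fun p => hV k hk _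
  have hierr : Integrable (fun w => ‖e (ascentIterate e α θ₀ (fun j => ζ j w) k) (ζ k w) -
      D (ascentIterate e α θ₀ (fun j => ζ j w) k)‖ ^ 2) P := by
    simp_rw [hΘ]
    exact integrable_comp_of_finite (hX.prodMk (hζ k hk))
      fun z => ‖e (Θ z.1) z.2 - D (Θ z.1)‖ ^ 2
  have hi0 := integrable_ascentIterate (P := P) (e := e) (α := α) (θ₀ := θ₀) hζ ρ hk.le
  have hi1 := integrable_ascentIterate (P := P) (e := e) (α := α) (θ₀ := θ₀) hζ ρ
    (Nat.succ_le_of_lt hk)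
  have hi2 := integrable_ascentIterate (P := P) (e := e) (α := α) (θ₀ := θ₀) hζ
    (fun θ => ‖D θ‖ ^ 2) hk.le
  have hi3 : Integrable (fun w => ρ (ascentIterate e α θ₀ (fun j => ζ j w) (k + 1)) -
      ρ (ascentIterate e α θ₀ (fun j => ζ j w) k)) P := hi1.sub hi0
  have hi4 : Integrable (fun w => ρ (ascentIterate e α θ₀ (fun j => ζ j w) (k + 1)) -
      ρ (ascentIterate e α θ₀ (fun j => ζ j w) k) +
      α / 2 * ‖e (ascentIterate e α θ₀ (fun j => ζ j w) k) (ζ k w) -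
        D (ascentIterate e α θ₀ (fun j => ζ j w) k)‖ ^ 2) P := hi3.add (hierr.const_mul _)
  have hmono := integral_mono_ae (hi2.const_mul (α / 2))
    (hi4.add (integrable_const (L / 2 * α ^ 2 * Q ^ 2))) (by
      filter_upwards [hQ k hk] with w hw
      have h1 := half_norm_sq_le_of_ascent hD hL hα (ascentIterate e α θ₀ (fun j => ζ j w) k)
        (e (ascentIterate e α θ₀ (fun j => ζ j w) k) (ζ k w))
      have h2 := hw (ascentIterate e α θ₀ (fun j => ζ j w) k)
      refine h1.trans ?_
      simp only [Pi.add_apply]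
      rw [ascentIterate]
      gcongr)
  simp only [Pi.add_apply] at hmono
  rw [integral_add hi4 (integrable_const _), integral_add hi3 (hierr.const_mul _),
    integral_sub hi1 hi0, integral_const_mul, integral_const_mul] at hmono
  simp only [integral_const, probReal_univ, one_smul] at hmono
  have := mul_le_mul_of_nonneg_left herr (by positivity : 0 ≤ α / 2)
  linarith

/-- Convergence of stochastic gradient ascent to a stationary point, at a random index which is
uniform on `{1, …, N}`. -/
theorem integral_norm_gradient_sq_ascentIterate_le [Nonempty T]
    (hD : ∀ θ, HasGradientAt ρ (D θ) θ)
    (hL0 : 0 ≤ L) (hL : ∀ θ θ', ‖D θ - D θ'‖ ≤ L * ‖θ - θ'‖) (hα : 0 < α)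
    (hζ : ∀ k < N, Measurable (ζ k))
    (hind : ∀ k < N, IndepFun (fun w (j : Fin k) => ζ j w) (ζ k) P) {Q V K ρs : ℝ}
    (hQ : ∀ k < N, ∀ᵐ w ∂P, ∀ θ, ‖e θ (ζ k w)‖ ≤ Q)
    (hV : ∀ k < N, ∀ θ, ∫ w, ‖e θ (ζ k w) - D θ‖ ^ 2 ∂P ≤ V)
    (hK : ∀ θ, ‖D θ‖ ≤ K) (hρs : ∀ θ, ρ θ ≤ ρs) (hN : 0 < N)
    {R : Ω → ℕ} (hR : Measurable R)
    (hRlaw : ∀ k ∈ Finset.Icc 1 N, P {w | R w = k} = (N : ENNReal)⁻¹)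
    (hRind : IndepFun R (fun w (j : Fin N) => ζ j w) P) :
    Integrable (fun w => ‖D (ascentIterate e α θ₀ (fun j => ζ j w) (R w))‖ ^ 2) P ∧
    ∫ w, ‖D (ascentIterate e α θ₀ (fun j => ζ j w) (R w))‖ ^ 2 ∂P ≤
      2 * (ρs - ρ θ₀) / (N * α) + V + L * α * Q ^ 2 + K ^ 2 / N := by
  classical
  have hN' : (0 : ℝ) < N := by exact_mod_cast hN
  set f : ℕ → Ω → ℝ := fun k w => ‖D (ascentIterate e α θ₀ (fun j => ζ j w) k)‖ ^ 2 with hf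
  have hfint : ∀ k ≤ N, Integrable (f k) P := fun k hk =>
    integrable_ascentIterate hζ (fun θ => ‖D θ‖ ^ 2) hk
  have hRmem : ∀ᵐ w ∂P, R w ∈ Finset.Icc 1 N := ae_mem_Icc_of_uniform hN hR hRlaw
  set I : ℕ → ℕ → ℝ := fun k r => if r = k then 1 else 0 with hI
  have hsplit : (fun w => ‖D (ascentIterate e α θ₀ (fun j => ζ j w) (R w))‖ ^ 2) =ᵐ[P]
      fun w => ∑ k ∈ Finset.Icc 1 N, I k (R w) * f k w := by
    filter_upwards [hRmem] with w hw
    simp [hI, hf, Finset.sum_ite_eq, hw]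
  have hIf : ∀ k ∈ Finset.Icc 1 N, Integrable (fun w => I k (R w) * f k w) P := by
    intro k hk
    refine (hfint k (Finset.mem_Icc.1 hk).2).bdd_mul (c := 1)
      ((Measurable.of_discrete (f := I k)).comp hR).aestronglyMeasurable (ae_of_all _ fun w => ?_)
    simp only [hI]
    split_ifs <;> simp
  -- The random index is independent of all batches, so evaluating at it is averaging over the
  -- indices `1, …, N`.
  have hprod : ∀ k ∈ Finset.Icc 1 N, ∫ w, I k (R w) * f k w ∂P = (N : ℝ)⁻¹ * ∫ w, f k w ∂P := by
    intro k hk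
    obtain ⟨Θ, hΘ⟩ := exists_ascentIterate_eq e α θ₀ (Finset.mem_Icc.1 hk).2
    simp only [hf, hΘ]
    rw [hRind.integral_fun_comp_mul_comp hR.aemeasurable
      (measurable_pi_lambda _ fun j : Fin N => hζ j j.2).aemeasurable
      (f := I k) (g := fun p => ‖D (Θ p)‖ ^ 2)
      (Measurable.of_discrete.aestronglyMeasurable)
      (StronglyMeasurable.of_discrete.aestronglyMeasurable)]
    congr 1
    have h1 : (fun w => I k (R w)) = Set.indicator {w | R w = k} 1 := by
      ext w
      simp [hI, Set.indicator_apply]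
    have h2 : MeasurableSet {w | R w = k} := hR (measurableSet_singleton k)
    rw [h1, integral_indicator_one h2, measureReal_def, hRlaw k hk]
    simp
  refine ⟨(integrable_congr hsplit).2 (integrable_finsetSum _ hIf), ?_⟩
  rw [integral_congr_ae hsplit, integral_finsetSum _ hIf, Finset.sum_congr rfl hprod,
    ← Finset.mul_sum]
  have hstep := fun k (hk : k ∈ Finset.range N) =>
    integral_norm_sq_ascentIterate_le (P := P) (θ₀ := θ₀) hD hL0 hL hα.le hζ hind hQ hV
      (Finset.mem_range.1 hk)
  have hsum := Finset.sum_le_sum hstep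
  rw [← Finset.mul_sum, Finset.sum_add_distrib, Finset.sum_range_sub
    (fun k => ∫ w, ρ (ascentIterate e α θ₀ (fun j => ζ j w) k) ∂P), Finset.sum_const,
    Finset.card_range, nsmul_eq_mul] at hsum
  have hlast : ∫ w, ρ (ascentIterate e α θ₀ (fun j => ζ j w) N) ∂P ≤ ρs := by
    refine (integral_mono (integrable_ascentIterate hζ ρ le_rfl) (integrable_const ρs)
      fun w => hρs _).trans_eq (by simp)
  have hfirst : ∫ w, ρ (ascentIterate e α θ₀ (fun j => ζ j w) 0) ∂P = ρ θ₀ := by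
    simp [ascentIterate]
  rw [hfirst] at hsum
  -- Telescoping controls the indices `0, …, N - 1`, whereas the random index ranges over `1, …, N`;
  -- the final iterate is bounded crudely by `K²`.
  have hshift : ∑ k ∈ Finset.Icc 1 N, ∫ w, f k w ∂P ≤ ∑ k ∈ Finset.range N, ∫ w, f k w ∂P + K ^ 2 := by
    have h1 : ∑ k ∈ Finset.Icc 1 N, ∫ w, f k w ∂P =
        ∑ k ∈ Finset.range N, ∫ w, f (k + 1) w ∂P := by
      rw [Finset.range_eq_Ico, Finset.sum_Ico_add' (fun k => ∫ w, f k w ∂P) 0 N 1]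
      rfl
    rw [h1]
    have h2 := Finset.sum_range_succ (fun k => ∫ w, f k w ∂P) N
    rw [Finset.sum_range_succ'] at h2
    have h3 : 0 ≤ ∫ w, f 0 w ∂P := integral_nonneg fun w => by positivity
    have h4 : ∫ w, f N w ∂P ≤ K ^ 2 := by
      refine (integral_mono (hfint N le_rfl) (integrable_const (K ^ 2)) fun w => ?_).trans_eq
        (by simp)
      exact pow_le_pow_left₀ (norm_nonneg _) (hK _) 2
    linarith
  have hS : ∑ k ∈ Finset.range N, ∫ w, f k w ∂P ≤
      2 * (ρs - ρ θ₀) / α + N * (V + L * α * Q ^ 2) := by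
    rw [← mul_le_mul_iff_of_pos_left (by positivity : 0 < α / 2)]
    have : α / 2 * (2 * (ρs - ρ θ₀) / α + N * (V + L * α * Q ^ 2)) =
        ρs - ρ θ₀ + N * (α / 2 * V + L / 2 * α ^ 2 * Q ^ 2) := by
      field_simp
    rw [this]
    linarith
  calc (N : ℝ)⁻¹ * ∑ k ∈ Finset.Icc 1 N, ∫ w, f k w ∂P
      ≤ (N : ℝ)⁻¹ * (2 * (ρs - ρ θ₀) / α + N * (V + L * α * Q ^ 2) + K ^ 2) := by
        gcongr
        linarith
    _ = _ := by field_simp; ring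

end Ascent

/-- Logarithmic differentiation of a finite product. -/
lemma hasGradientAt_prod {E : Type*} [NormedAddCommGroup E] [InnerProductSpace ℝ E]
    [CompleteSpace E] {f : ℕ → E → ℝ} {s : ℕ → E} {θ : E} (n : ℕ)
    (hf : ∀ t < n, HasGradientAt (f t) (f t θ • s t) θ) :
    HasGradientAt (fun θ => ∏ t ∈ Finset.range n, f t θ)
      ((∏ t ∈ Finset.range n, f t θ) • ∑ t ∈ Finset.range n, s t) θ := by
  induction n with
  | zero => simpa using hasGradientAt_const θ (1 : ℝ)
  | succ n ih =>
    have h1 := (ih fun t ht => hf t (by omega)).hasFDerivAt.fun_mul (hf n (by omega)).hasFDerivAt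
    simp_rw [Finset.prod_range_succ, Finset.sum_range_succ]
    rw [← map_smul, ← map_smul, ← map_add] at h1
    rw [hasGradientAt_iff_hasFDerivAt]
    refine h1.congr_fderiv (congrArg _ ?_)
    module

lemma ImportanceModel.intervalIntegrable_comp_cdf {H E : Type*} [Fintype H] [NormedAddCommGroup E]
    [InnerProductSpace ℝ E] [CompleteSpace E] (m : ImportanceModel H E) (g : ℝ → ℝ) (θ : E)
    (a b : ℝ) : IntervalIntegrable (fun x => g (1 - m.cdf θ x)) volume a b := by
  classical
  exact intervalIntegrable_pattern m.X (fun p => g (1 - ∑ h, (m.w h * if p h then 1 else 0) *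
    m.ψ θ h)) _ _

/-! ### From the decision process to the finite model -/

namespace EpisodicMDP

variable {S A : Type*} (M : EpisodicMDP S A) {d : ℕ}

lemma rewardBound_pos : 0 < M.rewardBound :=
  div_pos M.rmax_pos (sub_pos.2 M.γ_lt_one)

/-- Positivity allows writing the policy as the exponential of its logarithm, the only function
assumed smooth. -/
lemma hasGradientAt_policy {π : EuclideanSpace ℝ (Fin d) → S → PMF A} (hπ_pos : ∀ θ s a, π θ s a ≠ 0)
    (hπ_diff : ∀ s a, Differentiable ℝ (logPolicy π s a)) (s : S) (a : A)
    (θ : EuclideanSpace ℝ (Fin d)) :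
    HasGradientAt (fun θ => (π θ s a).toReal)
      ((π θ s a).toReal • gradient (logPolicy π s a) θ) θ := by
  have h1 : (fun θ => (π θ s a).toReal) = fun θ => Real.exp (logPolicy π s a θ) := by
    ext θ
    rw [logPolicy, Real.exp_log (ENNReal.toReal_pos (hπ_pos θ s a) (PMF.apply_ne_top _ _))]
  have h2 := (hπ_diff s a θ).hasGradientAt.hasFDerivAt.exp
  rw [hasGradientAt_iff_hasFDerivAt, map_smul, h1]
  rw [show (π θ s a).toReal = Real.exp (logPolicy π s a θ) from congrFun h1 θ]
  exact h2

lemma isRatio_nonneg (π b : S → PMF A) (ω : ℕ → S × A) : 0 ≤ M.isRatio π b ω :=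
  Finset.prod_nonneg fun _ _ => div_nonneg ENNReal.toReal_nonneg ENNReal.toReal_nonneg

lemma hasGradientAt_isRatio {π : EuclideanSpace ℝ (Fin d) → S → PMF A} (b : S → PMF A)
    (hπ_pos : ∀ θ s a, π θ s a ≠ 0) (hπ_diff : ∀ s a, Differentiable ℝ (logPolicy π s a))
    (ω : ℕ → S × A) (θ : EuclideanSpace ℝ (Fin d)) :
    HasGradientAt (fun θ => M.isRatio (π θ) b ω) (M.isRatio (π θ) b ω • M.score π θ ω) θ := by
  unfold isRatio score
  refine hasGradientAt_prod _ fun t _ => ?_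
  have h1 := (hasGradientAt_policy hπ_pos hπ_diff (ω t).1 (ω t).2 θ).hasFDerivAt.mul_const
    ((b (ω t).1 (ω t).2).toReal)⁻¹
  rw [hasGradientAt_iff_hasFDerivAt]
  simp_rw [div_eq_mul_inv]
  rw [← map_smul] at h1
  refine h1.congr_fderiv (congrArg _ ?_)
  rw [smul_smul, mul_comm]

lemma norm_score_le {π : EuclideanSpace ℝ (Fin d) → S → PMF A} {Md c : ℝ}
    (hMd : ∀ θ s a, ‖gradient (logPolicy π s a) θ‖ ≤ Md) {ω : ℕ → S × A}
    (hc : (M.length ω : ℝ) ≤ c) (θ : EuclideanSpace ℝ (Fin d)) : ‖M.score π θ ω‖ ≤ c * Md := by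
  have hMd0 : 0 ≤ Md := (norm_nonneg _).trans (hMd θ (ω 0).1 (ω 0).2)
  refine (norm_sum_le_of_le _ fun t _ => hMd θ _ _).trans ?_
  rw [Finset.sum_const, Finset.card_range, nsmul_eq_mul]
  exact mul_le_mul_of_nonneg_right hc hMd0

lemma differentiable_score {π : EuclideanSpace ℝ (Fin d) → S → PMF A}
    (hπ_diff2 : ∀ s a, Differentiable ℝ (gradient (logPolicy π s a))) (ω : ℕ → S × A) :
    Differentiable ℝ (M.score π · ω) := by
  unfold score
  exact Differentiable.fun_sum fun t _ => hπ_diff2 _ _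

lemma norm_fderiv_score_le {π : EuclideanSpace ℝ (Fin d) → S → PMF A}
    (hπ_diff2 : ∀ s a, Differentiable ℝ (gradient (logPolicy π s a))) {Mh c : ℝ}
    (hMh : ∀ θ s a, ‖fderiv ℝ (gradient (logPolicy π s a)) θ‖ ≤ Mh) {ω : ℕ → S × A}
    (hc : (M.length ω : ℝ) ≤ c) (θ : EuclideanSpace ℝ (Fin d)) :
    ‖fderiv ℝ (M.score π · ω) θ‖ ≤ c * Mh := by
  have hMh0 : 0 ≤ Mh := (norm_nonneg _).trans (hMh θ (ω 0).1 (ω 0).2)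
  unfold score
  rw [fderiv_fun_sum fun t _ => hπ_diff2 _ _ θ]
  refine (norm_sum_le_of_le _ fun t _ => hMh θ _ _).trans ?_
  rw [Finset.sum_const, Finset.card_range, nsmul_eq_mul]
  exact mul_le_mul_of_nonneg_right hc hMh0

lemma iterate_eq_ascentIterate {m : ℕ} (π : EuclideanSpace ℝ (Fin d) → S → PMF A) (b : S → PMF A)
    (g : ℝ → ℝ) (α : ℝ) (θ₀ : EuclideanSpace ℝ (Fin d)) (ξ : ℕ → Fin m → ℕ → S × A) (k : ℕ) :
    M.iterate π b g α θ₀ ξ k = ascentIterate (M.drmGradEstimate π b g) α θ₀ ξ k := by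
  induction k with
  | zero => rfl
  | succ k ih => rw [iterate, ascentIterate, ih]

variable [Fintype S] [Fintype A] [MeasurableSpace S] [DiscreteMeasurableSpace S]
  [MeasurableSpace A] [DiscreteMeasurableSpace A]

/-- The finite importance sampling model of the episodes of the behavior policy. -/
def importanceModel (a₀ : A) {π : EuclideanSpace ℝ (Fin d) → S → PMF A} {b : S → PMF A}
    (hb : ∀ s a, b s a ≠ 0)
    (hπ_pos : ∀ θ s a, π θ s a ≠ 0)
    (hπ_diff : ∀ s a, Differentiable ℝ (logPolicy π s a))
    (hπ_diff2 : ∀ s a, Differentiable ℝ (gradient (logPolicy π s a)))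
    {Md Mh Me Ms : ℝ}
    (hMd : ∀ θ s a, ‖gradient (logPolicy π s a) θ‖ ≤ Md)
    (hMh : ∀ θ s a, ‖fderiv ℝ (gradient (logPolicy π s a)) θ‖ ≤ Mh)
    (hMe : ∀ᵐ ω ∂M.law b M.start, M.Terminates ω ∧ (M.length ω : ℝ) ≤ Me)
    (hMs : ∀ θ, ∀ᵐ ω ∂M.law b M.start, M.isRatio (π θ) b ω ≤ Ms) :
    ImportanceModel (Fin (⌊Me⌋₊ + 1) → S × A) (EuclideanSpace ℝ (Fin d)) where
  w := M.pathWeight b a₀ ⌊Me⌋₊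
  X h := M.cumReward (extendPath h)
  ψ θ h := M.isRatio (π θ) b (extendPath h)
  sc θ h := M.score π θ (extendPath h)
  Ms := Ms
  B := Me * Md
  C := Me * Mh
  w_nonneg := M.pathWeight_nonneg b a₀ _
  sum_w := M.sum_pathWeight b a₀ _
  sum_w_mul_ψ θ := by
    have hK : ∀ᵐ ω ∂M.law b M.start, M.TerminatesBy ⌊Me⌋₊ ω := by
      filter_upwards [hMe] with ω hω using M.terminatesBy_floor hω.1 hω.2
    simp_rw [← M.pathWeight_eq_mul_isRatio hb hK]
    exact M.sum_pathWeight (π θ) a₀ _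
  ψ_nonneg θ h := M.isRatio_nonneg _ _ _
  -- The exceptional null set in `hMs` depends on `θ`, but it cannot contain a whole path event of
  -- positive weight; so on such paths the bound holds for all `θ` at once.
  ψ_le θ h hw := by
    obtain ⟨ω, rfl, hω, hωs⟩ := M.exists_of_pathWeight_ne_zero hw (hMe.and (hMs θ))
    rwa [M.isRatio_extendPath_truncate a₀ (M.terminatesBy_floor hω.1 hω.2)]
  hasGradientAt_ψ θ h := M.hasGradientAt_isRatio b hπ_pos hπ_diff _ θ
  norm_sc_le θ h hw := by
    obtain ⟨ω, rfl, hω⟩ := M.exists_of_pathWeight_ne_zero hw hMe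
    refine M.norm_score_le hMd ?_ θ
    rw [M.length_extendPath_truncate a₀ (M.terminatesBy_floor hω.1 hω.2)]
    exact hω.2
  differentiable_sc h := M.differentiable_score hπ_diff2 _
  norm_fderiv_sc_le θ h hw := by
    obtain ⟨ω, rfl, hω⟩ := M.exists_of_pathWeight_ne_zero hw hMe
    refine M.norm_fderiv_score_le hπ_diff2 hMh ?_ θ
    rw [M.length_extendPath_truncate a₀ (M.terminatesBy_floor hω.1 hω.2)]
    exact hω.2

section Model

variable (a₀ : A) {π : EuclideanSpace ℝ (Fin d) → S → PMF A} {b : S → PMF A}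
    (hb : ∀ s a, b s a ≠ 0)
    (hπ_pos : ∀ θ s a, π θ s a ≠ 0)
    (hπ_diff : ∀ s a, Differentiable ℝ (logPolicy π s a))
    (hπ_diff2 : ∀ s a, Differentiable ℝ (gradient (logPolicy π s a)))
    {Md Mh Me Ms : ℝ}
    (hMd : ∀ θ s a, ‖gradient (logPolicy π s a) θ‖ ≤ Md)
    (hMh : ∀ θ s a, ‖fderiv ℝ (gradient (logPolicy π s a)) θ‖ ≤ Mh)
    (hMe : ∀ᵐ ω ∂M.law b M.start, M.Terminates ω ∧ (M.length ω : ℝ) ≤ Me)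
    (hMs : ∀ θ, ∀ᵐ ω ∂M.law b M.start, M.isRatio (π θ) b ω ≤ Ms)

lemma rewardCDF_eq_cdf (θ : EuclideanSpace ℝ (Fin d)) (x : ℝ) :
    M.rewardCDF (π θ) x =
      (M.importanceModel a₀ hb hπ_pos hπ_diff hπ_diff2 hMd hMh hMe hMs).cdf θ x := by
  have hK : ∀ᵐ ω ∂M.law b M.start, M.TerminatesBy ⌊Me⌋₊ ω := by
    filter_upwards [hMe] with ω hω using M.terminatesBy_floor hω.1 hω.2
  rw [M.rewardCDF_eq_sum a₀ hb hK, ImportanceModel.cdf]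
  refine Finset.sum_congr rfl fun h _ => ?_
  by_cases hx : M.cumReward (extendPath h) ≤ x
  · have h1 : (M.importanceModel a₀ hb hπ_pos hπ_diff hπ_diff2 hMd hMh hMe hMs).ind x h = 1 :=
      if_pos hx
    rw [if_pos hx, h1, mul_one]
    rfl
  · have h1 : (M.importanceModel a₀ hb hπ_pos hπ_diff hπ_diff2 hMd hMh hMe hMs).ind x h = 0 :=
      if_neg hx
    rw [if_neg hx, h1, mul_zero, zero_mul]

/-- The two integrals merge into one up to a constant, which does not affect the gradient. -/
lemma drm_eq_integral_sub (g : ℝ → ℝ) (θ : EuclideanSpace ℝ (Fin d)) :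
    M.drm g (π θ) = (∫ x in (-M.rewardBound)..M.rewardBound,
      g (1 - (M.importanceModel a₀ hb hπ_pos hπ_diff hπ_diff2 hMd hMh hMe hMs).cdf θ x)) -
        M.rewardBound := by
  set I := M.importanceModel a₀ hb hπ_pos hπ_diff hπ_diff2 hMd hMh hMe hMs
  have hI : ∀ x, M.rewardCDF (π θ) x = I.cdf θ x :=
    M.rewardCDF_eq_cdf a₀ hb hπ_pos hπ_diff hπ_diff2 hMd hMh hMe hMs θ
  simp only [drm, hI]
  rw [intervalIntegral.integral_sub (I.intervalIntegrable_comp_cdf g θ _ _) (by simp),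
    ← intervalIntegral.integral_add_adjacent_intervals
      (I.intervalIntegrable_comp_cdf g θ (-M.rewardBound) 0)
      (I.intervalIntegrable_comp_cdf g θ 0 M.rewardBound), intervalIntegral.integral_const]
  simp only [smul_eq_mul]
  ring

lemma drmGradEstimate_eq_riskGradEst {g G : ℝ → ℝ} {m : ℕ}
    (hG : ∀ t ∈ Set.Icc (0 : ℝ) 1, HasDerivWithinAt g (G t) (Set.Icc 0 1) t)
    (θ : EuclideanSpace ℝ (Fin d)) {ω : Fin m → ℕ → S × A}
    (hω : ∀ i, M.TerminatesBy ⌊Me⌋₊ (ω i)) :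
    M.drmGradEstimate π b g θ ω =
      (M.importanceModel a₀ hb hπ_pos hπ_diff hπ_diff2 hMd hMh hMe hMs).riskGradEst G
        M.rewardBound θ (fun i => M.truncate a₀ ⌊Me⌋₊ (ω i)) := by
  set I := M.importanceModel a₀ hb hπ_pos hπ_diff hπ_diff2 hMd hMh hMe hMs with hI
  have h1 : ∀ x, M.cdfEstimate π b θ ω x =
      I.cdfEst θ (fun i => M.truncate a₀ ⌊Me⌋₊ (ω i)) x := by
    intro x
    unfold cdfEstimate ImportanceModel.cdfEst
    congr 2
    refine Finset.sum_congr rfl fun i _ => ?_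
    simp only [ImportanceModel.ind, hI, importanceModel, Set.indicator_apply, Set.mem_ofPred_eq,
      M.cumReward_extendPath_truncate a₀ (hω i), M.isRatio_extendPath_truncate a₀ (hω i)]
    split_ifs <;> simp
  have h2 : ∀ x, M.cdfGradEstimate π b θ ω x =
      I.cdfGradEst θ (fun i => M.truncate a₀ ⌊Me⌋₊ (ω i)) x := by
    intro x
    unfold cdfGradEstimate ImportanceModel.cdfGradEst
    congr 1
    refine Finset.sum_congr rfl fun i _ => ?_
    simp only [ImportanceModel.ind, hI, importanceModel, Set.indicator_apply, Set.mem_ofPred_eq,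
      M.cumReward_extendPath_truncate a₀ (hω i), M.isRatio_extendPath_truncate a₀ (hω i),
      M.score_extendPath_truncate a₀ (hω i)]
    split_ifs <;> simp
  unfold drmGradEstimate ImportanceModel.riskGradEst
  congr 1
  refine intervalIntegral.integral_congr fun x _ => ?_
  have h3 := I.one_sub_cdfEst_mem θ (fun i => M.truncate a₀ ⌊Me⌋₊ (ω i)) x
  simp only [h1, h2]
  rw [(hG _ h3).derivWithin (uniqueDiffOn_Icc zero_lt_one _ h3)]

end Model

end EpisodicMDP

end

/-! ### Assembly and comparison of constants -/

theorem mainTheorem5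
    {S A : Type*} [Fintype S] [Fintype A]
    [MeasurableSpace S] [DiscreteMeasurableSpace S]
    [MeasurableSpace A] [DiscreteMeasurableSpace A]
    (M : EpisodicMDP S A) {d : ℕ}
    -- the parameterized policies and the behavior policy
    (π : EuclideanSpace ℝ (Fin d) → S → PMF A) (b : S → PMF A)
    -- the distortion function
    (g : ℝ → ℝ) (hg0 : g 0 = 0) (hg1 : g 1 = 1)
    (hg_mono : MonotoneOn g (Set.Icc 0 1)) (hg_cont : ContinuousOn g (Set.Icc 0 1))
    (hg_diff : DifferentiableOn ℝ g (Set.Ioo 0 1))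
    (hg_diff2 : DifferentiableOn ℝ (deriv g) (Set.Ioo 0 1))
    (Mg' Mg'' : ℝ)
    (hMg' : ∀ t ∈ Set.Ioo (0 : ℝ) 1, |deriv g t| ≤ Mg')
    (hMg'' : ∀ t ∈ Set.Ioo (0 : ℝ) 1, |deriv (deriv g) t| ≤ Mg'')
    -- all policies are proper
    (hπ_proper : ∃ n : ℕ, 0 < n ∧ ∀ θ s, M.law (π θ) s {ω | (ω n).1 ≠ M.terminal} < 1)
    (hb_proper : ∃ n : ℕ, 0 < n ∧ ∀ s, M.law b s {ω | (ω n).1 ≠ M.terminal} < 1)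
    -- the policies are positive and smooth in the parameter, and dominated by the behavior policy
    (hπ_pos : ∀ θ s a, π θ s a ≠ 0)
    (hπ_ac : ∀ θ s a, b s a = 0 → π θ s a = 0)
    (hπ_diff : ∀ s a, Differentiable ℝ (EpisodicMDP.logPolicy π s a))
    (hπ_diff2 : ∀ s a, Differentiable ℝ (gradient (EpisodicMDP.logPolicy π s a)))
    (Md Mh : ℝ)
    (hMd : ∀ θ s a, ‖gradient (EpisodicMDP.logPolicy π s a) θ‖ ≤ Md)
    (hMh : ∀ θ s a, ‖fderiv ℝ (gradient (EpisodicMDP.logPolicy π s a)) θ‖ ≤ Mh)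
    -- almost sure bounds on the episode length and on the importance sampling ratio
    (Me Ms : ℝ)
    (hMe : ∀ᵐ ω ∂M.law b M.start, M.Terminates ω ∧ (M.length ω : ℝ) ≤ Me)
    (hMs : ∀ θ, ∀ᵐ ω ∂M.law b M.start, M.isRatio (π θ) b ω ≤ Ms)
    -- a run of the algorithm: `N` batches of `m` independent episodes of `b`, and a random index
    (N m : ℕ) (hN : 0 < N) (hm : m = ⌈√(N : ℝ)⌉₊) (θ₀ : EuclideanSpace ℝ (Fin d))
    {Ω : Type*} [MeasurableSpace Ω] (P : Measure Ω) [IsProbabilityMeasure P]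
    (ξ : ℕ → Fin m → Ω → ℕ → S × A)
    (hξ_meas : ∀ k < N, ∀ i, Measurable (ξ k i))
    (hξ_law : ∀ k < N, ∀ i, P.map (ξ k i) = M.law b M.start)
    (hξ_indep : iIndepFun (fun (j : Fin N × Fin m) => ξ j.1 j.2) P)
    (R : Ω → ℕ) (hR_meas : Measurable R)
    (hR_law : ∀ k ∈ Finset.Icc 1 N, P {w | R w = k} = (N : ENNReal)⁻¹)
    (hR_indep : IndepFun R (fun w (j : Fin N × Fin m) => ξ j.1 j.2 w) P) :
    let ρ : EuclideanSpace ℝ (Fin d) → ℝ := fun θ => M.drm g (π θ)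
    let Mr : ℝ := M.rewardBound
    let L : ℝ := 2 * Mr * Me * (Mh * Mg' + Me * Md ^ 2 * (Mg' + Mg''))
    let θ : Ω → ℕ → EuclideanSpace ℝ (Fin d) := fun w =>
      M.iterate π b g (1 / √(N : ℝ)) θ₀ (fun k i => ξ k i w)
    Differentiable ℝ ρ ∧ BddAbove (Set.range ρ) ∧
    Integrable (fun w => ‖gradient ρ (θ w (R w))‖ ^ 2) P ∧
    ∫ w, ‖gradient ρ (θ w (R w))‖ ^ 2 ∂P ≤
      2 * ((⨆ θ', ρ θ') - ρ θ₀) / √(N : ℝ) +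
      4 * Mr ^ 2 * Ms ^ 2 * Me ^ 2 * Md ^ 2 *
        (Mg' ^ 2 * L + 8 * (Real.exp 1 ^ 2 * Mg' ^ 2 + Mg'' ^ 2 * Ms ^ 2)) / √(N : ℝ) := by
  intro ρ Mr L θ
  obtain ⟨a₀⟩ : Nonempty A := (b M.start).support_nonempty.to_type
  -- Positive target policies dominated by `b` force `b` to have full support.
  have hb : ∀ s a, b s a ≠ 0 := fun s a h => hπ_pos 0 s a (hπ_ac 0 s a h)
  obtain ⟨G, hG₂, hG₁, hG⟩ :=
    exists_lipschitz_hasDerivWithinAt_Icc hg_cont hg_diff hg_diff2 hMg' hMg''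
  set K := ⌊Me⌋₊ with hKdef
  set I := M.importanceModel a₀ hb hπ_pos hπ_diff hπ_diff2 hMd hMh hMe hMs
  have hMr : 0 < Mr := M.rewardBound_pos
  have hMg'0 : 0 ≤ Mg' := (abs_nonneg _).trans (hMg' (1 / 2) (by norm_num))
  have hMg''0 : 0 ≤ Mg'' := (abs_nonneg _).trans (hMg'' (1 / 2) (by norm_num))
  have hN' : (0 : ℝ) < N := by exact_mod_cast hN
  have hsN : 0 < √(N : ℝ) := Real.sqrt_pos.2 hN'
  have hm0 : 0 < m := by rw [hm]; exact Nat.ceil_pos.2 hsN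
  have hmN : √(N : ℝ) ≤ m := by rw [hm]; exact Nat.le_ceil _
  -- the distortion risk measure and its gradient
  have hρ : ∀ θ', ρ θ' = (∫ x in (-Mr)..Mr, g (1 - I.cdf θ' x)) - Mr :=
    M.drm_eq_integral_sub a₀ hb hπ_pos hπ_diff hπ_diff2 hMd hMh hMe hMs g
  have hgrad : ∀ θ', HasGradientAt ρ (I.riskGrad G Mr θ') θ' := by
    intro θ'
    have h1 := (I.hasGradientAt_integral (Mr := Mr) hG₁ hG θ').hasFDerivAt.sub_const Mr
    rw [hasGradientAt_iff_hasFDerivAt, show ρ = _ from funext hρ]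
    exact h1
  have hbdd : BddAbove (Set.range ρ) := by
    refine ⟨Mr, ?_⟩
    rintro _ ⟨θ', rfl⟩
    have h1 : ‖∫ x in (-Mr)..Mr, g (1 - I.cdf θ' x)‖ ≤ 1 * |Mr - -Mr| := by
      refine intervalIntegral.norm_integral_le_of_norm_le_const fun x _ => ?_
      have h2 := I.one_sub_cdf_mem θ' x
      rw [Real.norm_of_nonneg]
      · exact (hg_mono h2 (Set.right_mem_Icc.2 zero_le_one) h2.2).trans_eq hg1
      · exact hg0.symm.trans_le (hg_mono (Set.left_mem_Icc.2 zero_le_one) h2 h2.1)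
    rw [abs_of_pos (by linarith)] at h1
    rw [hρ]
    linarith [le_abs_self (∫ x in (-Mr)..Mr, g (1 - I.cdf θ' x)), Real.norm_eq_abs
      (∫ x in (-Mr)..Mr, g (1 - I.cdf θ' x))]
  have hgradeq : ∀ θ', gradient ρ θ' = I.riskGrad G Mr θ' := fun θ' => (hgrad θ').gradient
  -- the truncated episodes
  set ζ : ℕ → Ω → Fin m → Fin (K + 1) → S × A := fun k w i => M.truncate a₀ K (ξ k i w) with hζdef
  have hζi : ∀ k < N, ∀ i, Measurable fun w => ζ k w i := fun k hk i =>
    (M.measurable_truncate a₀ K).comp (hξ_meas k hk i)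
  have hζ : ∀ k < N, Measurable (ζ k) := fun k hk => measurable_pi_lambda _ (hζi k hk)
  have hterm : ∀ k < N, ∀ᵐ w ∂P, ∀ i, M.TerminatesBy K (ξ k i w) := by
    intro k hk
    rw [ae_all_iff]
    intro i
    have h1 : ∀ᵐ ω ∂P.map (ξ k i), M.TerminatesBy K ω := by
      rw [hξ_law k hk i]
      filter_upwards [hMe] with ω hω using M.terminatesBy_floor hω.1 hω.2
    exact ae_of_ae_map (hξ_meas k hk i).aemeasurable h1
  have hlaw : ∀ k < N, ∀ i h, P.real {w | ζ k w i = h} = I.w h := by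
    intro k hk i h
    change _ = M.pathWeight b a₀ K h
    rw [EpisodicMDP.pathWeight, ← hξ_law k hk i, map_measureReal_apply (hξ_meas k hk i)]
    · rfl
    · exact M.measurable_truncate a₀ K (MeasurableSet.of_discrete (s := {h}))
  -- The bounds of the finite model concern paths of nonzero weight; almost surely only these are
  -- sampled.
  have hwne : ∀ k < N, ∀ᵐ w ∂P, ∀ i, I.w (ζ k w i) ≠ 0 := by
    intro k hk
    rw [ae_all_iff]
    intro i
    have h1 : {w | ¬ I.w (ζ k w i) ≠ 0} = ⋃ h : {h // I.w h = 0}, {w | ζ k w i = h} := by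
      ext w; simp
    rw [ae_iff, h1]
    refine measure_iUnion_null fun h => ?_
    rw [← measureReal_eq_zero_iff, hlaw k hk i, h.2]
  have hξ_meas' : ∀ j : Fin N × Fin m, Measurable (ξ j.1 j.2) := fun j => hξ_meas _ j.1.2 _
  have hpair : ∀ k < N, Pairwise fun i j => IndepFun (fun w => ζ k w i) (fun w => ζ k w j) P := by
    intro k hk i j hij
    exact (hξ_indep.indepFun (i := (⟨k, hk⟩, i)) (j := (⟨k, hk⟩, j)) (by simpa using hij)).comp
      (M.measurable_truncate a₀ K) (M.measurable_truncate a₀ K)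
  have hind : ∀ k < N, IndepFun (fun w (j : Fin k) => ζ j w) (ζ k) P := by
    intro k hk
    -- Disjoint blocks of an independent family are independent: the episodes of earlier batches,
    -- and those of batch `k`.
    have h1 := hξ_indep.indepFun_finset (Finset.univ.filter fun j => (j.1 : ℕ) < k)
      (Finset.univ.filter fun j => (j.1 : ℕ) = k) (by
        rw [Finset.disjoint_filter]
        intro j _ h1 h2
        omega) hξ_meas'
    refine h1.comp (φ := fun u (j : Fin k) i => M.truncate a₀ K
        (u ⟨(⟨j, j.2.trans hk⟩, i), by simp⟩))
      (ψ := fun u i => M.truncate a₀ K (u ⟨(⟨k, hk⟩, i), by simp⟩)) ?_ ?_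
    · exact measurable_pi_lambda _ fun j => measurable_pi_lambda _ fun i =>
        (M.measurable_truncate a₀ K).comp (measurable_pi_apply _)
    · exact measurable_pi_lambda _ fun i =>
        (M.measurable_truncate a₀ K).comp (measurable_pi_apply _)
  have hRind : IndepFun R (fun w (j : Fin N) => ζ j w) P := by
    refine hR_indep.comp (φ := id) (ψ := fun u (j : Fin N) i => M.truncate a₀ K (u (j, i)))
      measurable_id ?_
    exact measurable_pi_lambda _ fun j => measurable_pi_lambda _ fun i =>
      (M.measurable_truncate a₀ K).comp (measurable_pi_apply _)
  have : Nonempty (Fin m → Fin (K + 1) → S × A) := ⟨fun _ _ => (M.start, a₀)⟩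
  have hB := I.B_nonneg
  have hC := I.C_nonneg
  have hMs1 : 1 ≤ Ms := I.one_le_Ms
  obtain ⟨hint, hle⟩ := integral_norm_gradient_sq_ascentIterate_le (P := P) (θ₀ := θ₀)
    (α := 1 / √(N : ℝ)) (e := I.riskGradEst G Mr) (ρs := ⨆ θ', ρ θ') hgrad
    (by positivity : 0 ≤ 2 * Mr * (Mg' * (I.C + I.B ^ 2) + Mg'' * I.B ^ 2))
    (I.norm_riskGrad_sub_le hMr.le hG₁ hG₂) (by positivity) hζ hind
    (fun k hk => (hwne k hk).mono fun w hw θ' => I.norm_riskGradEst_le hMr.le hG₁ hm0 θ' hw)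
    (fun k hk θ' => I.integral_norm_riskGradEst_sub_sq_le hMr hG₁ hG₂ hm0 (hζi k hk) (hpair k hk)
      (hlaw k hk) θ')
    (I.norm_riskGrad_le hMr.le hG₁) (fun θ' => le_ciSup hbdd θ') hN hR_meas hR_law hRind
  -- the iterates agree almost surely with those of the finite model
  have hRN : ∀ᵐ w ∂P, R w ≤ N :=
    (ae_mem_Icc_of_uniform hN hR_meas hR_law).mono fun w hw => (Finset.mem_Icc.1 hw).2
  have hae : (fun w => ‖gradient ρ (θ w (R w))‖ ^ 2) =ᵐ[P] fun w =>
      ‖I.riskGrad G Mr (ascentIterate (I.riskGradEst G Mr) (1 / √(N : ℝ)) θ₀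
        (fun j => ζ j w) (R w))‖ ^ 2 := by
    have h1 : ∀ᵐ w ∂P, ∀ k, k < N → ∀ i, M.TerminatesBy K (ξ k i w) := by
      rw [ae_all_iff]
      intro k
      by_cases hk : k < N
      · filter_upwards [hterm k hk] with w hw _ using hw
      · exact ae_of_all _ fun w h => absurd h hk
    filter_upwards [h1, hRN] with w hw hwR
    rw [hgradeq]
    congr 3
    change M.iterate π b g _ θ₀ _ _ = _
    rw [EpisodicMDP.iterate_eq_ascentIterate]
    refine ascentIterate_congr fun j hj θ' => ?_
    exact M.drmGradEstimate_eq_riskGradEst a₀ hb hπ_pos hπ_diff hπ_diff2 hMd hMh hMe hMs hG θ'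
      (hw j (hj.trans_le hwR))
  refine ⟨fun θ' => (hgrad θ').differentiableAt, hbdd, (integrable_congr hae).2 hint, ?_⟩
  rw [integral_congr_ae hae]
  refine hle.trans ?_
  -- The model constants are `B = Me * Md` and `C = Me * Mh`. The Lipschitz constant then equals
  -- `L`, and the third term matches the `L` term of the claim exactly. The other two error terms
  -- must fit into the remaining part, whose coefficient is `32` against `8` and `4`.
  change 2 * ((⨆ θ', ρ θ') - ρ θ₀) / (N * (1 / √(N : ℝ))) +
    8 * Mr ^ 2 * Ms ^ 2 * (Me * Md) ^ 2 * (Mg' ^ 2 + Mg'' ^ 2) / m +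
    2 * Mr * (Mg' * (Me * Mh + (Me * Md) ^ 2) + Mg'' * (Me * Md) ^ 2) * (1 / √(N : ℝ)) *
      (2 * Mr * Mg' * (Ms * (Me * Md))) ^ 2 + (2 * Mr * Mg' * (Me * Md)) ^ 2 / N ≤ _
  have hs1 : 1 ≤ √(N : ℝ) := Real.one_le_sqrt.2 (by exact_mod_cast hN)
  have hss : √(N : ℝ) * √(N : ℝ) = N := Real.mul_self_sqrt hN'.le
  have hsleN : √(N : ℝ) ≤ N := by nlinarith
  have he : 1 ≤ Real.exp 1 ^ 2 := one_le_pow₀ (Real.one_le_exp zero_le_one)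
  have e1 : (N : ℝ) * (1 / √(N : ℝ)) = √(N : ℝ) := by
    rw [mul_one_div, div_eq_iff hsN.ne', hss]
  have e2 : 8 * Mr ^ 2 * Ms ^ 2 * (Me * Md) ^ 2 * (Mg' ^ 2 + Mg'' ^ 2) / m ≤
      8 * Mr ^ 2 * Ms ^ 2 * (Me * Md) ^ 2 * (Mg' ^ 2 + Mg'' ^ 2) / √(N : ℝ) := by gcongr
  have e3 : (2 * Mr * Mg' * (Me * Md)) ^ 2 / N ≤ (2 * Mr * Mg' * (Me * Md)) ^ 2 / √(N : ℝ) := by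
    gcongr
  have hMs2 : 1 ≤ Ms ^ 2 := one_le_pow₀ hMs1
  rw [e1]
  refine (add_le_add (add_le_add_left (add_le_add_right e2 _) _) e3).trans ?_
  rw [mul_one_div, div_mul_eq_mul_div, add_assoc, add_assoc, ← add_div, ← add_div]
  refine add_le_add_right (div_le_div_of_nonneg_right ?_ hsN.le) _
  set c := Mr ^ 2 * (Me * Md) ^ 2 with hc
  have hc0 : 0 ≤ c := by positivity
  -- `Ms ≥ 1` because the ratios have mean one; with `exp 1 ≥ 1` this inserts the extra factors of
  -- the stated bound.
  have f1 : c * Mg' ^ 2 ≤ c * Mg' ^ 2 * Ms ^ 2 := le_mul_of_one_le_right (by positivity) hMs2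
  have f2 : c * Mg' ^ 2 * Ms ^ 2 ≤ c * Mg' ^ 2 * Ms ^ 2 * Real.exp 1 ^ 2 :=
    le_mul_of_one_le_right (by positivity) he
  have f3 : c * Mg'' ^ 2 * Ms ^ 2 ≤ c * Mg'' ^ 2 * Ms ^ 2 * Ms ^ 2 :=
    le_mul_of_one_le_right (by positivity) hMs2
  have f4 : 0 ≤ c * Mg'' ^ 2 * Ms ^ 2 := by positivity
  have f5 : 0 ≤ c * Mg' ^ 2 * Ms ^ 2 := by positivity
  have k1 : 8 * Mr ^ 2 * Ms ^ 2 * (Me * Md) ^ 2 * (Mg' ^ 2 + Mg'' ^ 2) =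
      8 * (c * Mg' ^ 2 * Ms ^ 2) + 8 * (c * Mg'' ^ 2 * Ms ^ 2) := by rw [hc]; ring
  have k2 : (2 * Mr * Mg' * (Me * Md)) ^ 2 = 4 * (c * Mg' ^ 2) := by rw [hc]; ring
  have k3 : 4 * Mr ^ 2 * Ms ^ 2 * Me ^ 2 * Md ^ 2 *
      (Mg' ^ 2 * L + 8 * (Real.exp 1 ^ 2 * Mg' ^ 2 + Mg'' ^ 2 * Ms ^ 2)) =
      2 * Mr * (Mg' * (Me * Mh + (Me * Md) ^ 2) + Mg'' * (Me * Md) ^ 2) *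
        (2 * Mr * Mg' * (Ms * (Me * Md))) ^ 2 +
      32 * (c * Mg' ^ 2 * Ms ^ 2 * Real.exp 1 ^ 2) + 32 * (c * Mg'' ^ 2 * Ms ^ 2 * Ms ^ 2) := by
    rw [hc]; ring
  rw [k1, k2, k3]
  linarith
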